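/- Let $M$ be a smooth $n$-dimensional manifold without boundary and let $F:TM\to[0,\infty)$ be a Finsler metric: $F$ is smooth on $TM\setminus 0$, $F(x,cy)=cF(x,y)$ for $c>0$, and, in local coordinates $(x^i,y^i)$ of $TM$, the matrix $g_{ij}(x,y)=\frac12\frac{\partial^2F^2}{\partial y^i\partial y^j}(x,y)$ is positive definite for $y\neq0$. Put $$G^i(x,y)=\tfrac14 g^{il}\Big\{2\frac{\partial g_{jl}}{\partial x^k}-\frac{\partial g_{jk}}{\partial x^l}\Big\}y^jy^k ,$$ call a smooth curve $\gamma$ a geodesic if $\ddot\gamma^i+2G^i(\dot\gamma)=0$ in local coordinates, and call $F$ a Berwald metric if in every local coordinate system $G^i(x,y)=\frac12\Gamma^i_{jk}(x)y^jy^k$ for all $y\ne0$, with coefficients $\Gamma^i_{jk}$ depending only on $x$. The Holmes--Thompson measure $d\mu_{HT}=\sigma_{HT}(x)\,dx^1\wedge\cdots\wedge dx^n$ has the density $$\sigma_{HT}(x)=\frac1{\mathrm{vol}(\mathbb B^n)}\int_{\{y:\,F(x,y)<1\}}\det g_{ij}(x,y)\,dy^1\cdots dy^n ,$$ where $\mathbb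 B^n$ is the Euclidean unit ball. For $y\in T_xM\setminus\{0\}$ the distortion is $\tau_{HT}(y)=\log\frac{\sqrt{\det g_{ij}(x,y)}}{\sigma_{HT}(x)}$, and the S-curvature is $\mathbf S_{HT}(y)=\frac{d}{dt}\big|_{t=0}\tau_{HT}(\dot\gamma(t))$, where $\gamma$ is the geodesic with $\dot\gamma(0)=y$. Theorem. If $F$ is a Berwald metric, then the S-curvature for the Holmes--Thompson measure vanishes identically: for every $x\in M$ and every $y\in T_xM\setminus\{0\}$, the geodesic $\gamma$ with $\dot\gamma(0)=y$ exists on some interval $(-\varepsilon,\varepsilon)$, the function $t\mapsto\tau_{HT}(\dot\gamma(t))$ is differentiable at $t=0$, and $\mathbf S_{HT}(y)=0$. -/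

import Mathlib

open scoped Manifold ContDiff

noncomputable section

namespace FinslerGeom

/-- The model space `ℝⁿ`. -/
abbrev E (n : ℕ) : Type := EuclideanSpace ℝ (Fin n)

/-! ### Calculus in coordinates

Functions of `(x, y)`, where `x` are coordinates of a point and `y` are the
components of a tangent vector. -/

/-- The partial derivative `∂f/∂xⁱ` at `(x, y)`. -/
def partialX {n : ℕ} (f : E n → E n → ℝ) (i : Fin n) (x y : E n) : ℝ :=
  fderiv ℝ (fun x' => f x' y) x (EuclideanSpace.single i (1 : ℝ))

/-- The partial derivative `∂f/∂yⁱ` at `(x, y)`. -/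
def partialY {n : ℕ} (f : E n → E n → ℝ) (i : Fin n) (x y : E n) : ℝ :=
  fderiv ℝ (fun y' => f x y') y (EuclideanSpace.single i (1 : ℝ))

/-- The fundamental tensor `g_{ij}(x, y) = ½ ∂²(f²)/∂yⁱ∂yʲ` of a coordinate expression `f`. -/
def fundamentalMatrix {n : ℕ} (f : E n → E n → ℝ) (x y : E n) : Matrix (Fin n) (Fin n) ℝ :=
  Matrix.of fun i j => (1 / 2 : ℝ) * partialY (partialY (fun a b => f a b ^ 2) j) i x y

/-- The geodesic coefficients
`Gⁱ = ¼ g^{il} (2 ∂g_{jl}/∂xᵏ - ∂g_{jk}/∂xˡ) yʲ yᵏ` of a coordinate expression `f`. -/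
def geodesicCoeff {n : ℕ} (f : E n → E n → ℝ) (i : Fin n) (x y : E n) : ℝ :=
  (1 / 4 : ℝ) * ∑ l, ∑ j, ∑ k, (fundamentalMatrix f x y)⁻¹ i l *
    (2 * partialX (fun a b => fundamentalMatrix f a b j l) k x y
      - partialX (fun a b => fundamentalMatrix f a b j k) l x y) * y j * y k

/-- The Holmes–Thompson density
`σ(x) = vol(𝔹ⁿ)⁻¹ ∫_{f(x, y) < 1} det g_{ij}(x, y) dy` of a coordinate expression `f`. -/
def htDensityCoord {n : ℕ} (f : E n → E n → ℝ) (x : E n) : ℝ :=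
  (∫ y in {y : E n | f x y < 1}, (fundamentalMatrix f x y).det) /
    MeasureTheory.volume.real (Metric.ball (0 : E n) 1)

/-! ### Finsler manifolds -/

section Manifold

variable {n : ℕ} {M : Type*} [TopologicalSpace M] [ChartedSpace (E n) M]

/-- `IsChart e`: `e` is a chart of the maximal smooth atlas of `M`, i.e. a local coordinate
system. -/
def IsChart (e : OpenPartialHomeomorph M (E n)) : Prop :=
  e ∈ IsManifold.maximalAtlas (𝓡 n) ∞ M

/-- The expression of a function `F` on `TM` in the coordinates `(xⁱ, yⁱ)` of `TM` induced by
the chart `e`: its value at `(x, y)` is `F` of the tangent vector `yⁱ ∂/∂xⁱ` at the point with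
coordinates `x`. -/
def coordRep (F : TangentBundle (𝓡 n) M → ℝ) (e : OpenPartialHomeomorph M (E n))
    (x y : E n) : ℝ :=
  F ⟨e.symm x, mfderiv (𝓡 n) (𝓡 n) e.symm x y⟩

/-- The components `yⁱ` in the chart `e` of a tangent vector `v`. -/
def coordVec (e : OpenPartialHomeomorph M (E n)) (v : TangentBundle (𝓡 n) M) : E n :=
  mfderiv (𝓡 n) (𝓡 n) e v.1 v.2

/-- `F` is a Finsler metric on `M`: nonnegative, smooth off the zero section, positively
homogeneous of degree one, with positive definite fundamental tensor. -/
structure IsFinslerMetric [IsManifold (𝓡 n) ∞ M] (F : TangentBundle (𝓡 n) M → ℝ) : Prop where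
  nonneg : ∀ v, 0 ≤ F v
  smooth : ContMDiffOn (𝓡 n).tangent 𝓘(ℝ, ℝ) ∞ F {v | v.2 ≠ 0}
  homogeneous : ∀ (x : M) (y : TangentSpace (𝓡 n) x) (c : ℝ), 0 < c →
    F ⟨x, c • y⟩ = c * F ⟨x, y⟩
  posDef : ∀ e : OpenPartialHomeomorph M (E n), IsChart e → ∀ x ∈ e.target, ∀ y : E n, y ≠ 0 →
    (fundamentalMatrix (coordRep F e) x y).PosDef

/-- `F` is a Berwald metric: a Finsler metric such that in every local coordinate system the
geodesic coefficients are quadratic in `y`, `Gⁱ(x, y) = ½ Γⁱ_{jk}(x) yʲ yᵏ`. -/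
structure IsBerwaldMetric [IsManifold (𝓡 n) ∞ M] (F : TangentBundle (𝓡 n) M → ℝ) : Prop extends
    IsFinslerMetric F where
  quadratic : ∀ e : OpenPartialHomeomorph M (E n), IsChart e →
    ∃ Γ : E n → Fin n → Fin n → Fin n → ℝ, ∀ x ∈ e.target, ∀ y : E n, y ≠ 0 → ∀ i : Fin n,
      geodesicCoeff (coordRep F e) i x y = (1 / 2 : ℝ) * ∑ j, ∑ k, Γ x i j k * y j * y k

/-- The velocity `γ̇(t) ∈ TM` of a curve in `M`. -/
def velocity (γ : ℝ → M) (t : ℝ) : TangentBundle (𝓡 n) M :=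
  ⟨γ t, mfderiv 𝓘(ℝ, ℝ) (𝓡 n) γ t (1 : ℝ)⟩

/-- `γ` restricted to the open set `I` is a (constant speed) geodesic of `F`: it is smooth, and in
every local coordinate system `d²γⁱ/dt² + 2 Gⁱ(dγ/dt) = 0`. -/
structure IsGeodesicOn (F : TangentBundle (𝓡 n) M → ℝ) (γ : ℝ → M) (I : Set ℝ) : Prop where
  smooth : ContMDiffOn 𝓘(ℝ, ℝ) (𝓡 n) ∞ γ I
  equation : ∀ e : OpenPartialHomeomorph M (E n), IsChart e → ∀ t ∈ I, γ t ∈ e.source →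
    ∀ i : Fin n, deriv (deriv fun s => e (γ s)) t i +
      2 * geodesicCoeff (coordRep F e) i (e (γ t)) (deriv (fun s => e (γ s)) t) = 0

/-- The density of the Holmes–Thompson measure of `F` in local coordinates:
`dμ_HT = holmesThompson F e p dx¹ ∧ ⋯ ∧ dxⁿ` at `p` in the chart `e`. -/
def holmesThompson (F : TangentBundle (𝓡 n) M → ℝ) (e : OpenPartialHomeomorph M (E n))
    (p : M) : ℝ :=
  htDensityCoord (coordRep F e) (e p)

/-- The distortion `τ(v) = log (√(det g_{ij}(v)) / σ)` of a tangent vector `v`, evaluated in the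
chart `e`, for the measure on `M` whose density in a chart `e` is `σ e`. -/
def distortion (F : TangentBundle (𝓡 n) M → ℝ) (σ : OpenPartialHomeomorph M (E n) → M → ℝ)
    (e : OpenPartialHomeomorph M (E n)) (v : TangentBundle (𝓡 n) M) : ℝ :=
  Real.log (Real.sqrt (fundamentalMatrix (coordRep F e) (e v.1) (coordVec e v)).det / σ e v.1)

/-- `HasSCurvature F σ v s`: the S-curvature `d/dt τ(γ̇(t))` at `t = 0`, where `γ` is the geodesic
with `γ̇(0) = v`, for the measure with densities `σ`, exists and equals `s`.

Such a geodesic exists, and along every such geodesic, in every local coordinate system around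
the base point, the distortion is differentiable at `t = 0` with derivative `s`. -/
def HasSCurvature (F : TangentBundle (𝓡 n) M → ℝ)
    (σ : OpenPartialHomeomorph M (E n) → M → ℝ) (v : TangentBundle (𝓡 n) M) (s : ℝ) : Prop :=
  (∃ ε > 0, ∃ γ : ℝ → M, IsGeodesicOn F γ (Set.Ioo (-ε) ε) ∧ velocity γ 0 = v) ∧
  ∀ ε > 0, ∀ γ : ℝ → M, IsGeodesicOn F γ (Set.Ioo (-ε) ε) → velocity γ 0 = v →
    ∀ e : OpenPartialHomeomorph M (E n), IsChart e → v.1 ∈ e.source →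
      HasDerivAt (fun t => distortion F σ e (velocity γ t)) s 0

end Manifold

end FinslerGeom

end

open scoped Topology

noncomputable section

/-! ### Local Finsler metrics: fundamental tensor and Euler identities -/

namespace FinslerGeom

section

open Set Filter

variable {n : ℕ}

/-! On a Berwald manifold, parallel transport along a geodesic is a linear isometry between the
normed tangent spaces and carries velocity to velocity. The distortion is a linear invariant of a
normed space with a chosen vector, so it is constant along geodesics.

Write `E = F²` and let `G` be the spray. Pairing `G` with the fundamental tensor gives the
Euler–Lagrange identity `hess_sprayVec`. With Euler's homogeneity identities it yields `dE(b, -N b)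
= 0`, where `N` is the `y`-derivative of `G` (`fderiv_energy_horizontal`). For a Berwald metric `G =
½ Γ(y, y)`, so `N b = Γ(b, y)` is linear in `y`. The parallel transport equation `P' = -Γ(ċ, P)` is
then linear and its solutions preserve `E`; the geodesic equation says that `ċ` itself is parallel
(`exists_linearIsometry`).

Under a linear isometry `P`, `det g` changes by `(det P)²`. The Holmes–Thompson integral picks up
the same factor and also the Jacobian `|det P|⁻¹`, hence changes by `|det P|`, exactly as `√det g`
does (`distortion_of_linearIsometry`).

Existence of geodesics follows from smoothness of the spray (`contDiffOn_sprayVec`) and from the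
invariance of the Euler–Lagrange equation under coordinate changes (`IsCoordChange.geodesic`). -/

/-- A Finsler metric in coordinates: a function of `(x, y)` with `x` in the open set `U`. -/
structure IsLocalFinsler (f : E n → E n → ℝ) (U : Set (E n)) : Prop where
  isOpen : IsOpen U
  nonneg : ∀ x ∈ U, ∀ y, 0 ≤ f x y
  smooth : ContDiffOn ℝ ∞ (fun p : E n × E n => f p.1 p.2) (U ×ˢ {0}ᶜ)
  homogeneous : ∀ x ∈ U, ∀ (y : E n) (c : ℝ), 0 < c → f x (c • y) = c * f x y
  posDef : ∀ x ∈ U, ∀ y : E n, y ≠ 0 → (fundamentalMatrix f x y).PosDef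

/-- The function `(x, y) ↦ f(x, y)²`. -/
def energy (f : E n → E n → ℝ) (p : E n × E n) : ℝ := f p.1 p.2 ^ 2

/-- The second derivative of `energy f` at `p`. -/
def hess (f : E n → E n → ℝ) (p : E n × E n) : E n × E n →L[ℝ] E n × E n →L[ℝ] ℝ :=
  fderiv ℝ (fderiv ℝ (energy f)) p

/-- The geodesic coefficients as a vector. -/
def sprayVec (f : E n → E n → ℝ) (p : E n × E n) : E n :=
  WithLp.toLp 2 fun i => geodesicCoeff f i p.1 p.2

variable {f : E n → E n → ℝ} {U : Set (E n)} {x y : E n}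

theorem fderiv_comp_prodMk_left {G : Type*} [NormedAddCommGroup G] [NormedSpace ℝ G]
    {g : E n × E n → G} (h : DifferentiableAt ℝ g (x, y)) (a : E n) :
    fderiv ℝ (fun x' => g (x', y)) x a = fderiv ℝ g (x, y) (a, 0) := by
  have := (HasFDerivAt.comp (f := fun x' => (x', y)) x h.hasFDerivAt
    (hasFDerivAt_prodMk_left x y)).fderiv
  have h2 : (g ∘ fun x' => (x', y)) = fun x' => g (x', y) := rfl
  rw [h2] at this
  rw [this]; simp

theorem fderiv_comp_prodMk_right {G : Type*} [NormedAddCommGroup G] [NormedSpace ℝ G]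
    {g : E n × E n → G} (h : DifferentiableAt ℝ g (x, y)) (b : E n) :
    fderiv ℝ (fun y' => g (x, y')) y b = fderiv ℝ g (x, y) (0, b) := by
  have := (h.hasFDerivAt.comp y (hasFDerivAt_prodMk_right x y)).fderiv
  have h2 : (g ∘ fun y' => (x, y')) = fun y' => g (x, y') := rfl
  rw [h2] at this
  rw [this]; simp

theorem euclidean_sum_single (a : E n) : ∑ i, a i • EuclideanSpace.single i (1 : ℝ) = a := by
  simpa using (EuclideanSpace.basisFun (Fin n) ℝ).sum_repr a

namespace IsLocalFinsler

theorem isOpen_slit (h : IsLocalFinsler f U) : IsOpen (U ×ˢ ({0}ᶜ : Set (E n))) :=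
  h.isOpen.prod isOpen_compl_singleton

theorem contDiffOn_energy (h : IsLocalFinsler f U) : ContDiffOn ℝ ∞ (energy f) (U ×ˢ {0}ᶜ) :=
  h.smooth.pow 2

theorem contDiffOn_fderiv (h : IsLocalFinsler f U) :
    ContDiffOn ℝ ∞ (fderiv ℝ (energy f)) (U ×ˢ {0}ᶜ) :=
  h.contDiffOn_energy.fderiv_of_isOpen h.isOpen_slit (by simp)

theorem contDiffOn_hess (h : IsLocalFinsler f U) :
    ContDiffOn ℝ ∞ (hess f) (U ×ˢ {0}ᶜ) :=
  h.contDiffOn_fderiv.fderiv_of_isOpen h.isOpen_slit (by simp)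

theorem mem_nhds (h : IsLocalFinsler f U) (hx : x ∈ U) (hy : y ≠ 0) :
    U ×ˢ ({0}ᶜ : Set (E n)) ∈ 𝓝 (x, y) :=
  h.isOpen_slit.mem_nhds ⟨hx, hy⟩

theorem contDiffAt_energy (h : IsLocalFinsler f U) (hx : x ∈ U) (hy : y ≠ 0) :
    ContDiffAt ℝ ∞ (energy f) (x, y) :=
  h.contDiffOn_energy.contDiffAt (h.mem_nhds hx hy)

theorem differentiableAt_energy (h : IsLocalFinsler f U) (hx : x ∈ U) (hy : y ≠ 0) :
    DifferentiableAt ℝ (energy f) (x, y) :=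
  (h.contDiffAt_energy hx hy).differentiableAt (by simp)

theorem differentiableAt_fderiv (h : IsLocalFinsler f U) (hx : x ∈ U) (hy : y ≠ 0) :
    DifferentiableAt ℝ (fderiv ℝ (energy f)) (x, y) :=
  (h.contDiffOn_fderiv.contDiffAt (h.mem_nhds hx hy)).differentiableAt (by simp)

theorem differentiableAt_hess (h : IsLocalFinsler f U) (hx : x ∈ U) (hy : y ≠ 0) :
    DifferentiableAt ℝ (hess f) (x, y) :=
  (h.contDiffOn_hess.contDiffAt (h.mem_nhds hx hy)).differentiableAt (by simp)

theorem hess_symm (h : IsLocalFinsler f U) (hx : x ∈ U) (hy : y ≠ 0) (a b : E n × E n) :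
    hess f (x, y) a b = hess f (x, y) b a :=
  (h.contDiffAt_energy hx hy).isSymmSndFDerivAt (by simpa using WithTop.coe_le_coe.2 (le_top (a := (2 : ℕ∞)))) a b

/-- The fundamental tensor in terms of the second derivative. -/
theorem fundamentalMatrix_apply (h : IsLocalFinsler f U) (hx : x ∈ U) (hy : y ≠ 0)
    (i j : Fin n) : fundamentalMatrix f x y i j =
      1 / 2 * hess f (x, y) (0, EuclideanSpace.single i 1) (0, EuclideanSpace.single j 1) := by
  simp only [fundamentalMatrix, Matrix.of_apply]
  congr 1
  rw [partialY]
  have h1 : (fun y' => partialY (fun a b => f a b ^ 2) j x y') =ᶠ[𝓝 y]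
      fun y' => fderiv ℝ (energy f) (x, y') (0, EuclideanSpace.single j 1) := by
    filter_upwards [isOpen_compl_singleton.mem_nhds hy] with y' hy'
    exact fderiv_comp_prodMk_right (h.differentiableAt_energy hx hy') _
  rw [h1.fderiv_eq, fderiv_comp_prodMk_right
    (g := fun p => fderiv ℝ (energy f) p (0, EuclideanSpace.single j 1))
    ((h.differentiableAt_fderiv hx hy).clm_apply (differentiableAt_const _)),
    fderiv_clm_apply (h.differentiableAt_fderiv hx hy) (differentiableAt_const _)]
  simp [hess]

theorem dotProduct_fundamentalMatrix (h : IsLocalFinsler f U) (hx : x ∈ U) (hy : y ≠ 0)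
    (a b : E n) : ∑ i, ∑ j, fundamentalMatrix f x y i j * a i * b j =
      1 / 2 * hess f (x, y) (0, a) (0, b) := by
  have ha : ((0, a) : E n × E n) = ∑ i, a i • ((0, EuclideanSpace.single i 1) : E n × E n) := by
    conv_lhs => rw [← euclidean_sum_single a]
    ext <;> simp [Prod.fst_sum, Prod.snd_sum]
  have hb : ((0, b) : E n × E n) = ∑ i, b i • ((0, EuclideanSpace.single i 1) : E n × E n) := by
    conv_lhs => rw [← euclidean_sum_single b]
    ext <;> simp [Prod.fst_sum, Prod.snd_sum]
  rw [ha, hb]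
  simp only [map_sum, map_smul, sum_apply, smul_apply,
    Finset.mul_sum, smul_eq_mul, h.fundamentalMatrix_apply hx hy]
  rw [Finset.sum_comm]
  refine Finset.sum_congr rfl fun i _ => Finset.sum_congr rfl fun j _ => ?_
  ring

theorem hess_pos (h : IsLocalFinsler f U) (hx : x ∈ U) (hy : y ≠ 0) {a : E n} (ha : a ≠ 0) :
    0 < hess f (x, y) (0, a) (0, a) := by
  have h1 := (h.posDef x hx y hy).dotProduct_mulVec_pos (x := a.ofLp) (by simpa using ha)
  have h2 := h.dotProduct_fundamentalMatrix hx hy a a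
  simp only [dotProduct, Matrix.mulVec, star_trivial, Finset.mul_sum] at h1
  have h3 : ∑ i, ∑ j, fundamentalMatrix f x y i j * a i * a j
      = ∑ i, ∑ j, a i * (fundamentalMatrix f x y i j * a j) :=
    Finset.sum_congr rfl fun i _ => Finset.sum_congr rfl fun j _ => by ring
  linarith

/-- Nondegeneracy: identities tested against all vertical vectors become equalities of vectors. It
is used to invert the equation for the spray and to recover the geodesic equation from its
Euler–Lagrange form. -/
theorem eq_zero_of_hess (h : IsLocalFinsler f U) (hx : x ∈ U) (hy : y ≠ 0) {a : E n}
    (ha : ∀ b, hess f (x, y) (0, a) (0, b) = 0) : a = 0 := by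
  by_contra hne
  exact (h.hess_pos hx hy hne).ne' (ha a)

/-- Euler's identity for the energy. -/
theorem fderiv_energy_self (h : IsLocalFinsler f U) (hx : x ∈ U) (hy : y ≠ 0) :
    fderiv ℝ (energy f) (x, y) (0, y) = 2 * energy f (x, y) := by
  have hc : HasDerivAt (fun c : ℝ => (x, c • y)) ((0, y) : E n × E n) 1 := by
    simpa using (hasDerivAt_const (1 : ℝ) x).prodMk ((hasDerivAt_id (1 : ℝ)).smul_const y)
  have h0 : HasFDerivAt (energy f) (fderiv ℝ (energy f) (x, y)) (x, (1 : ℝ) • y) := by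
    rw [one_smul]; exact (h.differentiableAt_energy hx hy).hasFDerivAt
  have h1 := h0.comp_hasDerivAt (1 : ℝ) hc
  have h2 : HasDerivAt (fun c : ℝ => c ^ 2 * energy f (x, y)) (2 * energy f (x, y)) 1 := by
    simpa using (hasDerivAt_pow 2 (1 : ℝ)).mul_const (energy f (x, y))
  refine h1.unique (h2.congr_of_eventuallyEq ?_)
  filter_upwards [lt_mem_nhds (zero_lt_one (α := ℝ))] with c hc
  simp [energy, h.homogeneous x hx y c hc, mul_pow]

/-- Euler's identity for the derivative of the energy. -/
theorem hess_self (h : IsLocalFinsler f U) (hx : x ∈ U) (hy : y ≠ 0) (b : E n) :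
    hess f (x, y) (0, y) (0, b) = fderiv ℝ (energy f) (x, y) (0, b) := by
  have h1 : (fun p : E n × E n => fderiv ℝ (energy f) p (0, p.2)) =ᶠ[𝓝 (x, y)]
      fun p => 2 * energy f p := by
    filter_upwards [h.mem_nhds hx hy] with p hp using h.fderiv_energy_self hp.1 hp.2
  have h2 := congrArg (fun L : E n × E n →L[ℝ] ℝ => L (0, b)) h1.fderiv_eq
  rw [fderiv_const_mul (h.differentiableAt_energy hx hy),
    fderiv_clm_apply (h.differentiableAt_fderiv hx hy) (by fun_prop)] at h2
  have h3 : fderiv ℝ (fun p : E n × E n => ((0 : E n), p.2)) (x, y) (0, b) = (0, b) := by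
    rw [DifferentiableAt.fderiv_prodMk (by fun_prop) (by fun_prop)]
    simp [fderiv_snd]
  simp [h3] at h2
  rw [h.hess_symm hx hy, hess]
  linarith

/-- Euler's identity `dE(0, y) = 2E`, differentiated in the base direction `(a, 0)`. -/
theorem hess_left_self (h : IsLocalFinsler f U) (hx : x ∈ U) (hy : y ≠ 0) (a : E n) :
    hess f (x, y) (a, 0) (0, y) = 2 * fderiv ℝ (energy f) (x, y) (a, 0) := by
  have h1 : (fun p : E n × E n => fderiv ℝ (energy f) p (0, p.2)) =ᶠ[𝓝 (x, y)]
      fun p => 2 * energy f p := by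
    filter_upwards [h.mem_nhds hx hy] with p hp using h.fderiv_energy_self hp.1 hp.2
  have h2 := congrArg (fun L : E n × E n →L[ℝ] ℝ => L (a, 0)) h1.fderiv_eq
  rw [fderiv_const_mul (h.differentiableAt_energy hx hy),
    fderiv_clm_apply (h.differentiableAt_fderiv hx hy) (by fun_prop)] at h2
  have h3 : fderiv ℝ (fun p : E n × E n => ((0 : E n), p.2)) (x, y) (a, 0) = 0 := by
    rw [DifferentiableAt.fderiv_prodMk (by fun_prop) (by fun_prop)]
    simp [fderiv_snd]
  simp [h3] at h2
  rw [hess]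
  linarith

end IsLocalFinsler
end

end FinslerGeom

/-! ### The spray, the Euler–Lagrange identity and the horizontal derivative -/

namespace FinslerGeom

section

open Set Filter

variable {n : ℕ} {f : E n → E n → ℝ} {U : Set (E n)} {x y : E n}

namespace IsLocalFinsler

theorem differentiableAt_fundamentalMatrix (h : IsLocalFinsler f U) (hx : x ∈ U) (hy : y ≠ 0)
    (i j : Fin n) : DifferentiableAt ℝ (fun x' => fundamentalMatrix f x' y i j) x := by
  have h1 : (fun x' => fundamentalMatrix f x' y i j) =ᶠ[𝓝 x] fun x' => 1 / 2 *
      hess f (x', y) (0, EuclideanSpace.single i 1) (0, EuclideanSpace.single j 1) := by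
    filter_upwards [h.isOpen.mem_nhds hx] with x' hx' using h.fundamentalMatrix_apply hx' hy i j
  have h2 : DifferentiableAt ℝ (fun x' => hess f (x', y)) x :=
    DifferentiableAt.comp (g := hess f) x (f := fun x' => (x', y)) (h.differentiableAt_hess hx hy)
      (by fun_prop : DifferentiableAt ℝ (fun x' => (x', y)) x)
  exact ((((h2.clm_apply (differentiableAt_const _)).clm_apply
    (differentiableAt_const _)).const_mul _).congr_of_eventuallyEq h1)

theorem sum_fundamentalMatrix_mul (h : IsLocalFinsler f U) (hx : x ∈ U) (hy : y ≠ 0)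
    (m : Fin n) : ∑ j, fundamentalMatrix f x y j m * y j =
      1 / 2 * fderiv ℝ (energy f) (x, y) (0, EuclideanSpace.single m 1) := by
  rw [← h.hess_self hx hy, ← h.dotProduct_fundamentalMatrix hx hy]
  refine Finset.sum_congr rfl fun i _ => ?_
  rw [Finset.sum_eq_single m] <;> simp +contextual

theorem sum_sum_fundamentalMatrix_mul (h : IsLocalFinsler f U) (hx : x ∈ U) (hy : y ≠ 0) :
    ∑ j, ∑ k, fundamentalMatrix f x y j k * y j * y k = energy f (x, y) := by
  rw [h.dotProduct_fundamentalMatrix hx hy, h.hess_self hx hy, h.fderiv_energy_self hx hy]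
  ring

/-- Since `y` is held fixed, the identity for `∑ g_{jm} yʲ` may be differentiated in `x` term by
term. -/
theorem sum_fderiv_fundamentalMatrix_mul (h : IsLocalFinsler f U) (hx : x ∈ U) (hy : y ≠ 0)
    (m : Fin n) (a : E n) : ∑ j, fderiv ℝ (fun x' => fundamentalMatrix f x' y j m) x a * y j =
      1 / 2 * hess f (x, y) (a, 0) (0, EuclideanSpace.single m 1) := by
  have h1 : (fun x' => ∑ j, fundamentalMatrix f x' y j m * y j) =ᶠ[𝓝 x] fun x' => 1 / 2 *
      fderiv ℝ (energy f) (x', y) (0, EuclideanSpace.single m 1) := by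
    filter_upwards [h.isOpen.mem_nhds hx] with x' hx' using h.sum_fundamentalMatrix_mul hx' hy m
  have h2 : HasFDerivAt (fun x' => ∑ j, fundamentalMatrix f x' y j m * y j)
      (∑ j, y j • fderiv ℝ (fun x' => fundamentalMatrix f x' y j m) x) x :=
    HasFDerivAt.fun_sum fun j _ =>
      (h.differentiableAt_fundamentalMatrix hx hy j m).hasFDerivAt.mul_const (y j)
  have h3 : DifferentiableAt ℝ (fun p : E n × E n =>
      fderiv ℝ (energy f) p (0, EuclideanSpace.single m 1)) (x, y) :=
    (h.differentiableAt_fderiv hx hy).clm_apply (differentiableAt_const _)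
  have h4 : DifferentiableAt ℝ (fun x' : E n =>
      fderiv ℝ (energy f) (x', y) (0, EuclideanSpace.single m 1)) x :=
    h3.comp x (f := fun x' => (x', y)) (by fun_prop)
  have h5 : fderiv ℝ (fun x' => ∑ j, fundamentalMatrix f x' y j m * y j) x a =
      1 / 2 * hess f (x, y) (a, 0) (0, EuclideanSpace.single m 1) := by
    rw [h1.fderiv_eq, fderiv_const_mul h4, smul_apply, fderiv_comp_prodMk_left h3,
      fderiv_clm_apply (h.differentiableAt_fderiv hx hy) (differentiableAt_const _)]
    simp [hess]
  rw [← h5, h2.fderiv]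
  simp [mul_comm]

theorem sum_sum_fderiv_fundamentalMatrix_mul (h : IsLocalFinsler f U) (hx : x ∈ U) (hy : y ≠ 0)
    (a : E n) : ∑ j, ∑ k, fderiv ℝ (fun x' => fundamentalMatrix f x' y j k) x a * y j * y k =
      fderiv ℝ (energy f) (x, y) (a, 0) := by
  have h1 : (fun x' => ∑ j, ∑ k, fundamentalMatrix f x' y j k * y j * y k) =ᶠ[𝓝 x]
      fun x' => energy f (x', y) := by
    filter_upwards [h.isOpen.mem_nhds hx] with x' hx'
      using h.sum_sum_fundamentalMatrix_mul hx' hy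
  have h2 : HasFDerivAt (fun x' => ∑ j, ∑ k, fundamentalMatrix f x' y j k * y j * y k)
      (∑ j, ∑ k, y k • y j • fderiv ℝ (fun x' => fundamentalMatrix f x' y j k) x) x :=
    HasFDerivAt.fun_sum fun j _ => HasFDerivAt.fun_sum fun k _ =>
      ((h.differentiableAt_fundamentalMatrix hx hy j k).hasFDerivAt.mul_const (y j)).mul_const (y k)
  rw [← fderiv_comp_prodMk_left (h.differentiableAt_energy hx hy), ← h1.fderiv_eq, h2.fderiv]
  simp [mul_comm, mul_left_comm]

/-- Multiplying by `g` cancels `g⁻¹` in `Gⁱ`. Contraction with `yʲ yᵏ` then turns the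
first-derivative terms of `g` into a mixed second derivative and an `x`-derivative of the energy. -/
theorem fundamentalMatrix_mulVec_geodesicCoeff (h : IsLocalFinsler f U) (hx : x ∈ U) (hy : y ≠ 0)
    (m : Fin n) : 4 * ∑ i, fundamentalMatrix f x y m i * geodesicCoeff f i x y =
      hess f (x, y) (y, 0) (0, EuclideanSpace.single m 1) -
        fderiv ℝ (energy f) (x, y) (EuclideanSpace.single m 1, 0) := by
  set R : Fin n → ℝ := fun l => ∑ j, ∑ k,
    (2 * partialX (fun a b => fundamentalMatrix f a b j l) k x y
      - partialX (fun a b => fundamentalMatrix f a b j k) l x y) * y j * y k with hR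
  have hG : (fun i => geodesicCoeff f i x y) =
      (1 / 4 : ℝ) • ((fundamentalMatrix f x y)⁻¹.mulVec R) := by
    funext i
    simp only [geodesicCoeff, Pi.smul_apply, Matrix.mulVec, dotProduct, hR, Finset.mul_sum,
      smul_eq_mul]
    refine Finset.sum_congr rfl fun l _ => Finset.sum_congr rfl fun j _ =>
      Finset.sum_congr rfl fun k _ => by ring
  have hdet : IsUnit (fundamentalMatrix f x y).det := (h.posDef x hx y hy).det_pos.ne'.isUnit
  have h1 : (fundamentalMatrix f x y).mulVec (fun i => geodesicCoeff f i x y) =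
      (1 / 4 : ℝ) • R := by
    rw [hG, Matrix.mulVec_smul, Matrix.mulVec_mulVec, Matrix.mul_nonsing_inv _ hdet,
      Matrix.one_mulVec]
  have h2 := congrFun h1 m
  simp only [Matrix.mulVec, dotProduct, Pi.smul_apply, smul_eq_mul] at h2
  rw [h2, ← mul_assoc]
  norm_num
  simp only [hR, partialX, sub_mul, Finset.sum_sub_distrib]
  congr 1
  · rw [Finset.sum_comm]
    have h3 : ∀ k, ∑ j, 2 * fderiv ℝ (fun x' => fundamentalMatrix f x' y j m) x
        (EuclideanSpace.single k 1) * y j * y k =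
        y k * hess f (x, y) (EuclideanSpace.single k 1, 0) (0, EuclideanSpace.single m 1) := by
      intro k
      have := h.sum_fderiv_fundamentalMatrix_mul hx hy m (EuclideanSpace.single k 1)
      calc _ = 2 * y k * ∑ j, fderiv ℝ (fun x' => fundamentalMatrix f x' y j m) x
            (EuclideanSpace.single k 1) * y j := by
            rw [Finset.mul_sum]; exact Finset.sum_congr rfl fun j _ => by ring
        _ = _ := by rw [this]; ring
    rw [Finset.sum_congr rfl fun k _ => h3 k]
    have hy' : ((y, 0) : E n × E n) = ∑ i, y i • ((EuclideanSpace.single i 1, 0) : E n × E n) := by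
      conv_lhs => rw [← euclidean_sum_single y]
      ext <;> simp [Prod.fst_sum, Prod.snd_sum]
    rw [hy']
    simp only [map_sum, map_smul, sum_apply, smul_apply, smul_eq_mul]
  · exact h.sum_sum_fderiv_fundamentalMatrix_mul hx hy _

/-- The geodesic coefficients are characterized by the Euler–Lagrange expression of the energy. -/
theorem hess_sprayVec (h : IsLocalFinsler f U) (hx : x ∈ U) (hy : y ≠ 0) (b : E n) :
    2 * hess f (x, y) (0, sprayVec f (x, y)) (0, b) =
      hess f (x, y) (y, 0) (0, b) - fderiv ℝ (energy f) (x, y) (b, 0) := by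
  have key : ∀ m, 2 * hess f (x, y) (0, sprayVec f (x, y)) (0, EuclideanSpace.single m 1) =
      hess f (x, y) (y, 0) (0, EuclideanSpace.single m 1) -
        fderiv ℝ (energy f) (x, y) (EuclideanSpace.single m 1, 0) := by
    intro m
    rw [← h.fundamentalMatrix_mulVec_geodesicCoeff hx hy m, h.hess_symm hx hy]
    have h1 := h.dotProduct_fundamentalMatrix hx hy (EuclideanSpace.single m 1)
      (sprayVec f (x, y))
    have h2 : ∑ i, ∑ j, fundamentalMatrix f x y i j * (EuclideanSpace.single m (1 : ℝ)) i *
        (sprayVec f (x, y)) j = ∑ i, fundamentalMatrix f x y m i * geodesicCoeff f i x y := by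
      rw [Finset.sum_eq_single m] <;> simp +contextual [sprayVec]
    linarith
  have h1 : ((0, b) : E n × E n) = ∑ i, b i • ((0, EuclideanSpace.single i 1) : E n × E n) := by
    conv_lhs => rw [← euclidean_sum_single b]
    ext <;> simp [Prod.fst_sum, Prod.snd_sum]
  have h2 : ((b, 0) : E n × E n) = ∑ i, b i • ((EuclideanSpace.single i 1, 0) : E n × E n) := by
    conv_lhs => rw [← euclidean_sum_single b]
    ext <;> simp [Prod.fst_sum, Prod.snd_sum]
  rw [h1, h2]
  simp only [map_sum, map_smul, smul_eq_mul, Finset.mul_sum, ← Finset.sum_sub_distrib, ← mul_sub]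
  refine Finset.sum_congr rfl fun i _ => ?_
  rw [← key i]; ring

/-- The spray preserves the energy. -/
theorem fderiv_energy_sprayVec (h : IsLocalFinsler f U) (hx : x ∈ U) (hy : y ≠ 0) :
    2 * fderiv ℝ (energy f) (x, y) (0, sprayVec f (x, y)) =
      fderiv ℝ (energy f) (x, y) (y, 0) := by
  -- The choice `b = y` lets Euler's identities reduce every second derivative to a first one.
  have h1 := h.hess_sprayVec hx hy y
  rw [h.hess_symm hx hy, h.hess_self hx hy, h.hess_left_self hx hy] at h1
  linarith

/-- The horizontal derivative of the energy vanishes. -/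
theorem fderiv_energy_horizontal (h : IsLocalFinsler f U) (hx : x ∈ U) (hy : y ≠ 0)
    {N : E n →L[ℝ] E n} (hN : HasFDerivAt (fun y' => sprayVec f (x, y')) N y) (b : E n) :
    fderiv ℝ (energy f) (x, y) (0, N b) = fderiv ℝ (energy f) (x, y) (b, 0) := by
  have h0 : HasFDerivAt (fun y' => fderiv ℝ (energy f) (x, y'))
      ((hess f (x, y)).comp (ContinuousLinearMap.inr ℝ (E n) (E n))) y :=
    HasFDerivAt.comp (f := fun y' => (x, y')) y (h.differentiableAt_fderiv hx hy).hasFDerivAt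
      (hasFDerivAt_prodMk_right x y)
  have h1 := (h0.clm_apply ((hasFDerivAt_const (0 : E n) y).prodMk hN)).const_mul 2
  have h2 := h0.clm_apply ((hasFDerivAt_id y).prodMk (hasFDerivAt_const (0 : E n) y))
  have h3 : (fun y' => 2 * fderiv ℝ (energy f) (x, y') (0, sprayVec f (x, y'))) =ᶠ[𝓝 y]
      fun y' => fderiv ℝ (energy f) (x, y') (y', 0) := by
    filter_upwards [isOpen_compl_singleton.mem_nhds hy] with y' hy'
      using h.fderiv_energy_sprayVec hx hy'
  -- Conservation of energy, `2 dE(0, G) = dE(y, 0)`, differentiated in `y` along `b`. Its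
  -- second-order terms cancel against the Euler–Lagrange identity paired with `b`.
  have h4 := congrArg (fun L : E n →L[ℝ] ℝ => L b) (h1.unique (h2.congr_of_eventuallyEq h3))
  simp at h4
  have h5 := h.hess_sprayVec hx hy b
  rw [h.hess_symm hx hy (0, sprayVec f (x, y)), h.hess_symm hx hy (y, 0)] at h5
  linarith

end IsLocalFinsler
end

end FinslerGeom

/-! ### Linear isometries, invariance of the distortion, smoothness of the spray -/

namespace FinslerGeom

section

open Set Filter MeasureTheory

variable {n : ℕ} {f : E n → E n → ℝ} {U : Set (E n)} {x y : E n}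

namespace IsLocalFinsler

/-- The energies on the two tangent spaces differ by composition with `P`; as `P` is linear,
differentiating twice produces no term in the second derivative of `P`. -/
theorem hess_of_linearIsometry (h : IsLocalFinsler f U) {x₀ x₁ : E n} (hx₀ : x₀ ∈ U)
    (hx₁ : x₁ ∈ U) (P : E n ≃L[ℝ] E n) (hP : ∀ y, f x₁ (P y) = f x₀ y) (hy : y ≠ 0)
    (a b : E n) : hess f (x₀, y) (0, a) (0, b) = hess f (x₁, P y) (0, P a) (0, P b) := by
  have hPne : ∀ z : E n, z ≠ 0 → P z ≠ 0 := fun z hz => by simpa using hz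
  have h1 : ∀ z : E n, z ≠ 0 →
      fderiv ℝ (energy f) (x₀, z) (0, b) = fderiv ℝ (energy f) (x₁, P z) (0, P b) := by
    intro z hz
    rw [← fderiv_comp_prodMk_right (h.differentiableAt_energy hx₀ hz)]
    have h2 : (fun z' => energy f (x₀, z')) = fun z' => energy f (x₁, P z') := by
      funext z'; simp [energy, hP]
    have h3 : HasFDerivAt (fun z' => (x₁, P z'))
        ((0 : E n →L[ℝ] E n).prod (P : E n →L[ℝ] E n)) z :=
      (hasFDerivAt_const x₁ z).prodMk P.hasFDerivAt
    have h4 := HasFDerivAt.comp (g := energy f) (f := fun z' => (x₁, P z')) z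
      (h.differentiableAt_energy hx₁ (hPne z hz)).hasFDerivAt h3
    rw [h2]
    exact congrArg (fun L : E n →L[ℝ] ℝ => L b) h4.fderiv
  have h2 : (fun z => fderiv ℝ (energy f) (x₀, z) (0, b)) =ᶠ[𝓝 y]
      fun z => fderiv ℝ (energy f) (x₁, P z) (0, P b) := by
    filter_upwards [isOpen_compl_singleton.mem_nhds hy] with z hz using h1 z hz
  have h3 : HasFDerivAt (fun z => fderiv ℝ (energy f) (x₀, z))
      ((hess f (x₀, y)).comp (ContinuousLinearMap.inr ℝ (E n) (E n))) y :=
    HasFDerivAt.comp (f := fun z => (x₀, z)) y (h.differentiableAt_fderiv hx₀ hy).hasFDerivAt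
      (hasFDerivAt_prodMk_right x₀ y)
  have h4 : HasFDerivAt (fun z => fderiv ℝ (energy f) (x₁, P z))
      ((hess f (x₁, P y)).comp ((0 : E n →L[ℝ] E n).prod (P : E n →L[ℝ] E n))) y :=
    HasFDerivAt.comp (f := fun z => (x₁, P z)) y
      (h.differentiableAt_fderiv hx₁ (hPne y hy)).hasFDerivAt
      ((hasFDerivAt_const x₁ y).prodMk P.hasFDerivAt)
  have h5 := congrArg (fun L : E n →L[ℝ] ℝ => L a)
    ((h3.clm_apply (hasFDerivAt_const ((0, b) : E n × E n) y)).unique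
    ((h4.clm_apply (hasFDerivAt_const ((0, P b) : E n × E n) y)).congr_of_eventuallyEq h2))
  simpa using h5

theorem det_fundamentalMatrix_of_linearIsometry (h : IsLocalFinsler f U) {x₀ x₁ : E n}
    (hx₀ : x₀ ∈ U) (hx₁ : x₁ ∈ U) (P : E n ≃L[ℝ] E n) (hP : ∀ y, f x₁ (P y) = f x₀ y)
    (hy : y ≠ 0) : (fundamentalMatrix f x₀ y).det =
      LinearMap.det (P : E n →ₗ[ℝ] E n) ^ 2 * (fundamentalMatrix f x₁ (P y)).det := by
  set b := (EuclideanSpace.basisFun (Fin n) ℝ).toBasis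
  set A := LinearMap.toMatrix b b (P : E n →ₗ[ℝ] E n) with hA
  have hAij : ∀ i j, A i j = P (EuclideanSpace.single j 1) i := by
    intro i j
    simp [hA, LinearMap.toMatrix_apply, b]
  have h1 : fundamentalMatrix f x₀ y = A.transpose * fundamentalMatrix f x₁ (P y) * A := by
    ext i j
    rw [h.fundamentalMatrix_apply hx₀ hy, h.hess_of_linearIsometry hx₀ hx₁ P hP hy,
      ← h.dotProduct_fundamentalMatrix hx₁ (by simpa using hy)]
    simp only [Matrix.mul_apply, Matrix.transpose_apply, hAij, Finset.sum_mul]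
    rw [Finset.sum_comm]
    refine Finset.sum_congr rfl fun k _ => Finset.sum_congr rfl fun l _ => by ring
  rw [h1, Matrix.det_mul, Matrix.det_mul, Matrix.det_transpose, hA, LinearMap.det_toMatrix]
  ring

/-- The factor is `d² · |d|⁻¹`: the square from `det g`, the inverse from the change of variables
between unit balls. Every step is valid without integrability. -/
theorem htDensityCoord_of_linearIsometry (h : IsLocalFinsler f U) [Nontrivial (E n)]
    {x₀ x₁ : E n} (hx₀ : x₀ ∈ U) (hx₁ : x₁ ∈ U) (P : E n ≃L[ℝ] E n)
    (hP : ∀ y, f x₁ (P y) = f x₀ y) :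
    htDensityCoord f x₀ = |LinearMap.det (P : E n →ₗ[ℝ] E n)| * htDensityCoord f x₁ := by
  set d := LinearMap.det (P : E n →ₗ[ℝ] E n) with hd
  have hd0 : d ≠ 0 := (LinearEquiv.isUnit_det' P.toLinearEquiv).ne_zero
  have hmap := Measure.map_linearMap_addHaar_eq_smul_addHaar (volume : Measure (E n)) hd0
  have hemb : MeasurableEmbedding (P : E n → E n) := P.toHomeomorph.measurableEmbedding
  have h1 := hemb.setIntegral_map (μ := volume) (fun z => (fundamentalMatrix f x₁ z).det)
    {z | f x₁ z < 1}
  have hmap' : Measure.map (P : E n → E n) volume = ENNReal.ofReal |d⁻¹| • volume := hmap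
  rw [hmap', Measure.restrict_smul, integral_smul_measure] at h1
  have h2 : (P : E n → E n) ⁻¹' {z | f x₁ z < 1} = {z | f x₀ z < 1} := by
    ext z; simp [hP]
  have h3 : ∫ y in {z | f x₀ z < 1}, (fundamentalMatrix f x₀ y).det =
      d ^ 2 * ∫ y in {z | f x₀ z < 1}, (fundamentalMatrix f x₁ (P y)).det := by
    rw [← integral_const_mul]
    refine integral_congr_ae (ae_restrict_of_ae ?_)
    -- The transformation of `det g` is known only off the origin, a null set because the space is
    -- nontrivial.
    have : ∀ᵐ y : E n, y ≠ 0 := by simp [ae_iff]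
    filter_upwards [this] with y hy
      using h.det_fundamentalMatrix_of_linearIsometry hx₀ hx₁ P hP hy
  rw [h2] at h1
  rw [htDensityCoord, htDensityCoord, h3, ← h1, ENNReal.toReal_ofReal (abs_nonneg _), abs_inv,
    smul_eq_mul, ← sq_abs d]
  have : |d| ≠ 0 := abs_ne_zero.2 hd0
  field_simp

/-- The ratio in the distortion is preserved by linear isometries between tangent spaces. -/
theorem distortion_of_linearIsometry (h : IsLocalFinsler f U) {x₀ x₁ : E n}
    (hx₀ : x₀ ∈ U) (hx₁ : x₁ ∈ U) (P : E n ≃L[ℝ] E n) (hP : ∀ y, f x₁ (P y) = f x₀ y)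
    (hy : y ≠ 0) : √(fundamentalMatrix f x₁ (P y)).det / htDensityCoord f x₁ =
      √(fundamentalMatrix f x₀ y).det / htDensityCoord f x₀ := by
  have : Nontrivial (E n) := ⟨y, 0, hy⟩
  rw [h.det_fundamentalMatrix_of_linearIsometry hx₀ hx₁ P hP hy,
    h.htDensityCoord_of_linearIsometry hx₀ hx₁ P hP, Real.sqrt_mul (sq_nonneg _), Real.sqrt_sq_eq_abs]
  have hd0 : LinearMap.det (P : E n →ₗ[ℝ] E n) ≠ 0 :=
    (LinearEquiv.isUnit_det' P.toLinearEquiv).ne_zero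
  -- Only `|det P|` is cancelled, so positivity of the density is not needed.
  exact (mul_div_mul_left _ _ (abs_ne_zero.2 hd0)).symm

/-- The Euler–Lagrange identity is a linear system `A(p) G = r(p)` with smooth data and invertible
`A(p)`, and inversion of operators is smooth. -/
theorem contDiffOn_sprayVec (h : IsLocalFinsler f U) :
    ContDiffOn ℝ ∞ (sprayVec f) (U ×ˢ {0}ᶜ) := by
  set T₁ : (E n × E n →L[ℝ] ℝ) →L[ℝ] (E n →L[ℝ] ℝ) :=
    (ContinuousLinearMap.compL ℝ (E n) (E n × E n) ℝ).flip (ContinuousLinearMap.inl ℝ (E n) (E n))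
  set T₂ : (E n × E n →L[ℝ] ℝ) →L[ℝ] (E n →L[ℝ] ℝ) :=
    (ContinuousLinearMap.compL ℝ (E n) (E n × E n) ℝ).flip (ContinuousLinearMap.inr ℝ (E n) (E n))
  -- Riesz duality makes the vertical Hessian an endomorphism, so injectivity suffices for
  -- invertibility.
  set D : (E n →L[ℝ] ℝ) ≃L[ℝ] E n := (InnerProductSpace.toDual ℝ (E n)).symm.toContinuousLinearEquiv
  set A : E n × E n → E n →L[ℝ] E n := fun p =>
    ((D : (E n →L[ℝ] ℝ) →L[ℝ] E n).comp T₂).comp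
      ((hess f p).comp (ContinuousLinearMap.inr ℝ (E n) (E n)))
  set r : E n × E n → E n := fun p =>
    D ((1 / 2 : ℝ) • (T₂ (hess f p (p.2, 0)) - T₁ (fderiv ℝ (energy f) p)))
  have hA : ContDiffOn ℝ ∞ A (U ×ˢ {0}ᶜ) :=
    contDiffOn_const.clm_comp (h.contDiffOn_hess.clm_comp contDiffOn_const)
  have hr : ContDiffOn ℝ ∞ r (U ×ˢ {0}ᶜ) := by
    have h1 : ContDiffOn ℝ ∞ (fun p : E n × E n => hess f p (p.2, 0)) (U ×ˢ {0}ᶜ) :=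
      h.contDiffOn_hess.clm_apply (by fun_prop)
    have h2 : ContDiffOn ℝ ∞ (fun p : E n × E n =>
        T₂ (hess f p (p.2, 0)) - T₁ (fderiv ℝ (energy f) p)) (U ×ˢ {0}ᶜ) :=
      (T₂.contDiff.comp_contDiffOn h1).sub (T₁.contDiff.comp_contDiffOn h.contDiffOn_fderiv)
    exact D.contDiff.comp_contDiffOn (h2.const_smul (1 / 2 : ℝ))
  have hEq : ∀ p ∈ U ×ˢ ({0}ᶜ : Set (E n)), ∃ e : E n ≃L[ℝ] E n,
      (e : E n →L[ℝ] E n) = A p ∧ e (sprayVec f p) = r p := by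
    rintro ⟨x, y⟩ ⟨hx, hy⟩
    have hinj : Function.Injective (A (x, y) : E n →ₗ[ℝ] E n) := by
      rw [injective_iff_map_eq_zero]
      intro a ha
      refine h.eq_zero_of_hess hx hy fun b => ?_
      have h1 : T₂ (hess f (x, y) (0, a)) = 0 := D.map_eq_zero_iff.1 ha
      exact congrArg (fun L : E n →L[ℝ] ℝ => L b) h1
    refine ⟨(LinearEquiv.ofInjectiveEndo _ hinj).toContinuousLinearEquiv, ?_, ?_⟩
    · ext1 a; rfl
    · change D (T₂ (hess f (x, y) (0, sprayVec f (x, y)))) = _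
      refine congrArg D ?_
      ext1 b
      change hess f (x, y) (0, sprayVec f (x, y)) (0, b) = (1 / 2 : ℝ) *
        (hess f (x, y) (y, 0) (0, b) - fderiv ℝ (energy f) (x, y) (b, 0))
      rw [← h.hess_sprayVec hx hy b]
      ring
  have hinv : ContDiffOn ℝ ∞ (fun p => (A p).inverse (r p)) (U ×ˢ {0}ᶜ) := by
    refine ContDiffOn.clm_apply (fun p hp => ?_) hr
    obtain ⟨e, he, -⟩ := hEq p hp
    have h1 := contDiffAt_map_inverse (𝕜 := ℝ) (n := ∞) e
    rw [he] at h1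
    exact h1.comp_contDiffWithinAt p (hA p hp)
  refine hinv.congr fun p hp => ?_
  obtain ⟨e, he, he'⟩ := hEq p hp
  rw [← he, ← he', ContinuousLinearMap.inverse_equiv]
  simp

end IsLocalFinsler

/-! ### The Berwald connection -/

/-- The Berwald connection of `f` at `x`, obtained by polarization of the geodesic
coefficients. -/
def connection (f : E n → E n → ℝ) (x : E n) : E n →L[ℝ] E n →L[ℝ] E n :=
  ∑ j, ∑ k, (EuclideanSpace.proj j : E n →L[ℝ] ℝ).smulRight
    ((EuclideanSpace.proj k : E n →L[ℝ] ℝ).smulRight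
      (sprayVec f (x, EuclideanSpace.single j 1 + EuclideanSpace.single k 1) -
        sprayVec f (x, EuclideanSpace.single j 1) - sprayVec f (x, EuclideanSpace.single k 1)))

theorem connection_apply (f : E n → E n → ℝ) (x a b : E n) : connection f x a b =
    ∑ j, ∑ k, a j • b k •
      (sprayVec f (x, EuclideanSpace.single j 1 + EuclideanSpace.single k 1) -
        sprayVec f (x, EuclideanSpace.single j 1) - sprayVec f (x, EuclideanSpace.single k 1)) := by
  simp [connection, sum_apply]

theorem connection_symm (f : E n → E n → ℝ) (x a b : E n) :
    connection f x a b = connection f x b a := by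
  rw [connection_apply, connection_apply, Finset.sum_comm]
  refine Finset.sum_congr rfl fun j _ => Finset.sum_congr rfl fun k _ => ?_
  rw [smul_comm, add_comm (EuclideanSpace.single k (1 : ℝ)), sub_right_comm]

/-- Quadraticity is assumed only for `y ≠ 0`; polarization evaluates the spray at these vectors,
including `j = k`. -/
theorem single_add_single_ne_zero (j k : Fin n) :
    EuclideanSpace.single j (1 : ℝ) + EuclideanSpace.single k 1 ≠ 0 := by
  intro h
  have := congrArg (fun v : E n => v j) h
  by_cases hjk : j = k
  · subst hjk; norm_num at this
  · simp [hjk] at this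

theorem single_ne_zero (j : Fin n) : EuclideanSpace.single j (1 : ℝ) ≠ 0 := by simp

/-- A Finsler metric in coordinates whose geodesic coefficients are quadratic. -/
structure IsLocalBerwald (f : E n → E n → ℝ) (U : Set (E n)) : Prop extends
    IsLocalFinsler f U where
  quadratic : ∃ Γ : E n → Fin n → Fin n → Fin n → ℝ, ∀ x ∈ U, ∀ y : E n, y ≠ 0 → ∀ i : Fin n,
      geodesicCoeff f i x y = (1 / 2 : ℝ) * ∑ j, ∑ k, Γ x i j k * y j * y k

namespace IsLocalBerwald

/-- Polarization gives the symmetrization `½ (Γⁱ_{jk} + Γⁱ_{kj})`, which has the same quadratic form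
as `Γ`. -/
theorem sprayVec_eq (h : IsLocalBerwald f U) (hx : x ∈ U) (hy : y ≠ 0) :
    sprayVec f (x, y) = (1 / 2 : ℝ) • connection f x y y := by
  obtain ⟨Γ, hΓ⟩ := h.quadratic
  ext i
  have h1 : ∀ j, sprayVec f (x, EuclideanSpace.single j 1) i = 1 / 2 * Γ x i j j := by
    intro j
    rw [show sprayVec f (x, EuclideanSpace.single j 1) i =
      geodesicCoeff f i x (EuclideanSpace.single j 1) from rfl, hΓ x hx _ (single_ne_zero j)]
    simp
  have h2 : ∀ j k, sprayVec f (x, EuclideanSpace.single j 1 + EuclideanSpace.single k 1) i =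
      1 / 2 * (Γ x i j j + Γ x i j k + Γ x i k j + Γ x i k k) := by
    intro j k
    rw [show sprayVec f (x, EuclideanSpace.single j 1 + EuclideanSpace.single k 1) i =
      geodesicCoeff f i x (EuclideanSpace.single j 1 + EuclideanSpace.single k 1) from rfl,
      hΓ x hx _ (single_add_single_ne_zero j k)]
    simp [mul_add, Finset.sum_add_distrib]
    ring
  rw [show sprayVec f (x, y) i = geodesicCoeff f i x y from rfl, hΓ x hx y hy, connection_apply]
  simp only [PiLp.smul_apply, WithLp.ofLp_sum, Finset.sum_apply, PiLp.sub_apply, h1, h2,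
    smul_eq_mul]
  congr 1
  have h3 : ∑ j, ∑ k, Γ x i k j * y j * y k = ∑ j, ∑ k, Γ x i j k * y j * y k := by
    rw [Finset.sum_comm]
    exact Finset.sum_congr rfl fun j _ => Finset.sum_congr rfl fun k _ => by ring
  have h4 : ∑ j, ∑ k, y j * (y k * (1 / 2 * (Γ x i j j + Γ x i j k + Γ x i k j + Γ x i k k) -
      1 / 2 * Γ x i j j - 1 / 2 * Γ x i k k)) = ∑ j, ∑ k, (1 / 2 * (Γ x i j k * y j * y k) +
        1 / 2 * (Γ x i k j * y j * y k)) :=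
    Finset.sum_congr rfl fun j _ => Finset.sum_congr rfl fun k _ => by ring
  refine Eq.trans ?_ h4.symm
  simp only [Finset.sum_add_distrib, ← Finset.mul_sum]
  rw [h3]; ring

/-- No regularity of `Γ` is assumed: the connection inherits it from the spray evaluated at finitely
many fixed nonzero vectors. -/
theorem contDiffOn_connection (h : IsLocalBerwald f U) : ContDiffOn ℝ ∞ (connection f) U := by
  have h1 : ∀ v : E n, v ≠ 0 → ContDiffOn ℝ ∞ (fun x => sprayVec f (x, v)) U := fun v hv =>
    h.contDiffOn_sprayVec.comp (contDiffOn_id.prodMk contDiffOn_const) fun x hx => ⟨hx, hv⟩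
  refine ContDiffOn.sum fun j _ => ContDiffOn.sum fun k _ => ?_
  exact contDiffOn_const.smulRight (contDiffOn_const.smulRight
    (((h1 _ (single_add_single_ne_zero j k)).sub (h1 _ (single_ne_zero j))).sub
      (h1 _ (single_ne_zero k))))

theorem hasFDerivAt_sprayVec (h : IsLocalBerwald f U) (hx : x ∈ U) (hy : y ≠ 0) :
    HasFDerivAt (fun y' => sprayVec f (x, y')) (connection f x y) y := by
  have h1 : (fun y' => sprayVec f (x, y')) =ᶠ[𝓝 y]
      fun y' => (1 / 2 : ℝ) • connection f x y' y' := by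
    filter_upwards [isOpen_compl_singleton.mem_nhds hy] with y' hy' using h.sprayVec_eq hx hy'
  refine HasFDerivAt.congr_of_eventuallyEq ?_ h1
  convert! (((connection f x).hasFDerivAt (x := y)).clm_apply (hasFDerivAt_id y)).const_smul
    (1 / 2 : ℝ) using 1
  ext1 b
  simp [connection_symm f x b y, ← two_smul ℝ, smul_smul]

/-- The energy is invariant under parallel displacement. -/
theorem fderiv_energy_connection (h : IsLocalBerwald f U) (hx : x ∈ U) (hy : y ≠ 0) (b : E n) :
    fderiv ℝ (energy f) (x, y) (b, -connection f x b y) = 0 := by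
  have h1 := h.fderiv_energy_horizontal hx hy (h.hasFDerivAt_sprayVec hx hy) b
  rw [connection_symm] at h1
  have h2 : ((b, -connection f x b y) : E n × E n) = (b, 0) - (0, connection f x b y) := by
    simp
  rw [h2, map_sub, h1, sub_self]

end IsLocalBerwald
end

end FinslerGeom

/-! ### Differential equations: geodesics and parallel transport -/

namespace FinslerGeom

section

open Set Filter MeasureTheory

theorem eqOn_Ioo_of_hasDerivAt_zero {V : Type*} [NormedAddCommGroup V] [NormedSpace ℝ V]
    {u : ℝ → V} {ε : ℝ} (hu : ∀ t ∈ Ioo (-ε) ε, HasDerivAt u 0 t) {t : ℝ} (ht : t ∈ Ioo (-ε) ε) :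
    u t = u 0 := by
  have h0 : (0 : ℝ) ∈ Ioo (-ε) ε := ⟨by linarith [ht.1, ht.2], by linarith [ht.1, ht.2]⟩
  exact isOpen_Ioo.is_const_of_deriv_eq_zero isPreconnected_Ioo
    (fun s hs => (hu s hs).differentiableAt.differentiableWithinAt) (fun s hs => (hu s hs).deriv)
    ht h0

theorem exists_Ioo_of_eventually {p : ℝ → Prop} (h : ∀ᶠ t in 𝓝 (0 : ℝ), p t) :
    ∃ ε > 0, ∀ t ∈ Ioo (-ε) ε, p t := by
  obtain ⟨ε, hε, h⟩ := Metric.eventually_nhds_iff_ball.1 h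
  refine ⟨ε, hε, fun t ht => h t ?_⟩
  rw [Real.ball_eq_Ioo]
  simpa using ht

/-- Local existence for linear ordinary differential equations. -/
theorem exists_eventually_hasDerivAt_linear {V : Type*} [NormedAddCommGroup V] [NormedSpace ℝ V]
    [CompleteSpace V] {A : ℝ → V →L[ℝ] V} (hA : ContDiffAt ℝ 1 A 0) (v : V) :
    ∃ u : ℝ → V, u 0 = v ∧ ∀ᶠ t in 𝓝 (0 : ℝ), HasDerivAt u (A t (u t)) t := by
  -- Time is adjoined as a coordinate of speed `1`, which makes the equation autonomous.
  have hX : ContDiffAt ℝ 1 (fun p : ℝ × V => ((1 : ℝ), A p.1 p.2)) (0, v) := by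
    have h1 : ContDiffAt ℝ 1 (fun p : ℝ × V => A p.1) (0, v) :=
      ContDiffAt.comp (g := A) (f := Prod.fst) _ hA contDiffAt_fst
    exact contDiffAt_const.prodMk (h1.clm_apply contDiffAt_snd)
  obtain ⟨α, h0, ε, hε, hα⟩ :=
    hX.exists_forall_mem_closedBall_exists_eq_forall_mem_Ioo_hasDerivAt₀ 0
  rw [zero_sub, zero_add] at hα
  have h1 : ∀ t ∈ Ioo (-ε) ε, (α t).1 = t := by
    intro t ht
    have := eqOn_Ioo_of_hasDerivAt_zero (u := fun s => (α s).1 - s) (ε := ε) (fun s hs => by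
      have h2 := ((hasFDerivAt_fst (p := α s)).comp_hasDerivAt s (hα s hs)).sub (hasDerivAt_id s)
      change HasDerivAt _ ((1 : ℝ) - 1) s at h2
      rwa [sub_self] at h2) ht
    simp only [h0] at this
    linarith
  refine ⟨fun t => (α t).2, by simp [h0], ?_⟩
  filter_upwards [Ioo_mem_nhds (neg_lt_zero.2 hε) hε] with t ht
  have h2 := (hasFDerivAt_snd (p := α t)).comp_hasDerivAt t (hα t ht)
  simp only [h1 t ht] at h2
  exact h2

variable {n : ℕ} {f : E n → E n → ℝ} {U : Set (E n)} {x y : E n}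

namespace IsLocalFinsler

theorem apply_zero (h : IsLocalFinsler f U) (hx : x ∈ U) : f x 0 = 0 := by
  have := h.homogeneous x hx 0 2 two_pos
  rw [smul_zero] at this
  linarith

/-- Local existence of geodesics. -/
theorem exists_geodesic (h : IsLocalFinsler f U) (hx : x ∈ U) (hy : y ≠ 0) :
    ∃ ε > 0, ∃ c : ℝ → E n, c 0 = x ∧ deriv c 0 = y ∧ ContDiffOn ℝ ∞ c (Ioo (-ε) ε) ∧
      ∀ t ∈ Ioo (-ε) ε, c t ∈ U ∧ deriv c t ≠ 0 ∧
        deriv (deriv c) t = (-2 : ℝ) • sprayVec f (c t, deriv c t) := by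
  set X : E n × E n → E n × E n := fun p => (p.2, (-2 : ℝ) • sprayVec f p)
  have hX : ContDiffOn ℝ ∞ X (U ×ˢ {0}ᶜ) :=
    contDiffOn_snd.prodMk (h.contDiffOn_sprayVec.const_smul (-2 : ℝ))
  obtain ⟨α, h0, ε, hε, hα⟩ := ((hX.contDiffAt (h.mem_nhds hx hy)).of_le
    (by exact_mod_cast le_top)).exists_forall_mem_closedBall_exists_eq_forall_mem_Ioo_hasDerivAt₀ 0
  rw [zero_sub, zero_add] at hα
  have hcont : ContinuousAt α 0 := (hα 0 ⟨neg_lt_zero.2 hε, hε⟩).continuousAt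
  obtain ⟨δ, hδ, hδS⟩ := exists_Ioo_of_eventually (hcont.eventually_mem
    (show U ×ˢ ({0}ᶜ : Set (E n)) ∈ 𝓝 (α 0) by rw [h0]; exact h.mem_nhds hx hy))
  -- Halving puts the closed interval `[-η, η]` inside both open ones; smoothness of the solution is
  -- obtained on a closed interval.
  set η := min ε δ / 2
  have hη : 0 < η := by positivity
  have hηε : η < ε := by have := min_le_left ε δ; simp only [η]; linarith
  have hηδ : η < δ := by have := min_le_right ε δ; simp only [η]; linarith
  have hsub : ∀ t ∈ Icc (-η) η, t ∈ Ioo (-ε) ε ∧ t ∈ Ioo (-δ) δ := fun t ht =>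
    ⟨⟨by linarith [ht.1], by linarith [ht.2]⟩, ⟨by linarith [ht.1], by linarith [ht.2]⟩⟩
  have hsm : ContDiffOn ℝ ∞ α (Icc (-η) η) := by
    refine ODE.contDiffOn_enat_Icc_of_hasDerivWithinAt (n := ⊤) (f := fun _ => X)
      (u := U ×ˢ {0}ᶜ) ?_ (fun t ht => (hα t (hsub t ht).1).hasDerivWithinAt)
      (fun t ht => hδS t (hsub t ht).2)
    exact hX.comp contDiffOn_snd fun p hp => hp.2
  have hd1 : ∀ t ∈ Ioo (-η) η, HasDerivAt (fun t => (α t).1) (α t).2 t := fun t ht =>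
    (hasFDerivAt_fst (p := α t)).comp_hasDerivAt t (hα t (hsub t (Ioo_subset_Icc_self ht)).1)
  have hd2 : ∀ t ∈ Ioo (-η) η, HasDerivAt (fun t => (α t).2) ((-2 : ℝ) • sprayVec f (α t)) t :=
    fun t ht =>
    (hasFDerivAt_snd (p := α t)).comp_hasDerivAt t (hα t (hsub t (Ioo_subset_Icc_self ht)).1)
  have h00 : (0 : ℝ) ∈ Ioo (-η) η := ⟨neg_lt_zero.2 hη, hη⟩
  refine ⟨η, hη, fun t => (α t).1, by simp [h0], by rw [(hd1 0 h00).deriv, h0],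
    contDiff_fst.comp_contDiffOn (hsm.mono Ioo_subset_Icc_self), fun t ht => ?_⟩
  have hS := hδS t (hsub t (Ioo_subset_Icc_self ht)).2
  have h3 : deriv (fun t => (α t).1) =ᶠ[𝓝 t] fun t => (α t).2 := by
    filter_upwards [isOpen_Ioo.mem_nhds ht] with s hs using (hd1 s hs).deriv
  refine ⟨hS.1, ?_, ?_⟩
  · rw [(hd1 t ht).deriv]; exact hS.2
  · rw [h3.deriv_eq, (hd2 t ht).deriv, (hd1 t ht).deriv]

end IsLocalFinsler

namespace IsLocalBerwald

/-- Along a geodesic of a Berwald metric the tangent spaces are linearly isometric, by maps which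
preserve the velocity. -/
theorem exists_linearIsometry (h : IsLocalBerwald f U) {c : ℝ → E n} (hc : ContDiffAt ℝ ∞ c 0)
    (hcU : c 0 ∈ U) (hc0 : deriv c 0 ≠ 0)
    (hgeo : ∀ᶠ t in 𝓝 (0 : ℝ), deriv (deriv c) t = (-2 : ℝ) • sprayVec f (c t, deriv c t)) :
    ∀ᶠ t in 𝓝 (0 : ℝ), ∃ P : E n ≃L[ℝ] E n, (∀ y, f (c t) (P y) = f (c 0) y) ∧
      P (deriv c 0) = deriv c t := by
  have hw : ContDiffAt ℝ ∞ (deriv c) 0 := by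
    have := hc.fderiv_right (m := ∞) (by simp)
    exact this.clm_apply contDiffAt_const
  set A : ℝ → E n →L[ℝ] E n := fun t => -connection f (c t) (deriv c t) with hAdef
  have hA : ContDiffAt ℝ ∞ A 0 := by
    have h1 : ContDiffAt ℝ ∞ (fun t => connection f (c t)) 0 :=
      ContDiffAt.comp (g := connection f) 0
        (h.contDiffOn_connection.contDiffAt (h.isOpen.mem_nhds hcU)) hc
    exact (h1.clm_apply hw).neg
  have hA1 : ContDiffAt ℝ 1 A 0 := hA.of_le (by exact_mod_cast le_top)
  obtain ⟨P, hP0, hP⟩ := exists_eventually_hasDerivAt_linear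
    (A := fun t => ContinuousLinearMap.compL ℝ (E n) (E n) (E n) (A t))
    (contDiffAt_const.clm_apply hA1)
    (ContinuousLinearMap.id ℝ (E n))
  -- `P' = A P` is parallel transport; `Q' = -Q A` is built to be its inverse, since then `(Q P)' =
  -- 0`.
  obtain ⟨Q, hQ0, hQ⟩ := exists_eventually_hasDerivAt_linear
    (A := fun t => (ContinuousLinearMap.compL ℝ (E n) (E n) (E n)).flip (-A t))
    (contDiffAt_const.clm_apply hA1.neg)
    (ContinuousLinearMap.id ℝ (E n))
  have hc1 : ContDiffAt ℝ 1 c 0 := hc.of_le (by exact_mod_cast le_top)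
  have hw1 : ContDiffAt ℝ 1 (deriv c) 0 := hw.of_le (by exact_mod_cast le_top)
  have hcd : ∀ᶠ t in 𝓝 (0 : ℝ), HasDerivAt c (deriv c t) t := by
    filter_upwards [hc1.eventually (by simp)] with t ht
      using (ht.differentiableAt (by simp)).hasDerivAt
  have hwd : ∀ᶠ t in 𝓝 (0 : ℝ), HasDerivAt (deriv c) (deriv (deriv c) t) t := by
    filter_upwards [hw1.eventually (by simp)] with t ht
      using (ht.differentiableAt (by simp)).hasDerivAt
  obtain ⟨ε, hε, H⟩ := exists_Ioo_of_eventually (hP.and (hQ.and (hcd.and (hwd.and (hgeo.and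
    ((hc.continuousAt.eventually_mem (h.isOpen.mem_nhds hcU)).and
      (hw.continuousAt.eventually_ne hc0)))))))
  have hQP : ∀ t ∈ Ioo (-ε) ε, (Q t).comp (P t) = ContinuousLinearMap.id ℝ (E n) := by
    intro t ht
    have := eqOn_Ioo_of_hasDerivAt_zero (u := fun s => (Q s).comp (P s)) (ε := ε) (fun s hs => by
      convert! (H s hs).2.1.clm_comp (H s hs).1 using 1
      ext1 a
      simp) ht
    simpa [hP0, hQ0] using this
  have hQw : ∀ t ∈ Ioo (-ε) ε, Q t (deriv c t) = deriv c 0 := by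
    intro t ht
    -- The derivative is `Q (Γ(ċ, ċ) + c̈)`, which vanishes by the geodesic equation.
    have := eqOn_Ioo_of_hasDerivAt_zero (u := fun s => Q s (deriv c s)) (ε := ε) (fun s hs => by
      obtain ⟨-, h2, -, h4, h5, h6, h7⟩ := H s hs
      convert! h2.clm_apply h4 using 1
      rw [h5, h.sprayVec_eq h6 h7]
      simp [hAdef, smul_smul]) ht
    simpa [hQ0] using this
  filter_upwards [Ioo_mem_nhds (neg_lt_zero.2 hε) hε] with t ht
  have hPQ : (P t : E n →ₗ[ℝ] E n) * (Q t : E n →ₗ[ℝ] E n) = 1 := by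
    -- In finite dimension a left inverse is also a right inverse.
    rw [mul_eq_one_comm]
    ext1 a
    exact congrArg (fun L : E n →L[ℝ] E n => L a) (hQP t ht)
  have hPQ' : ∀ a, P t (Q t a) = a := fun a => congrArg (fun L : E n →ₗ[ℝ] E n => L a) hPQ
  have hQP' : ∀ s ∈ Ioo (-ε) ε, ∀ a, Q s (P s a) = a := fun s hs a =>
    congrArg (fun L : E n →L[ℝ] E n => L a) (hQP s hs)
  refine ⟨ContinuousLinearEquiv.equivOfInverse (P t) (Q t) (hQP' t ht) hPQ', fun y => ?_, ?_⟩
  · change f (c t) (P t y) = f (c 0) y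
    -- The energy need not be smooth at zero vectors, so `y = 0` is treated by homogeneity.
    rcases eq_or_ne y 0 with rfl | hy
    · rw [map_zero, h.apply_zero (H t ht).2.2.2.2.2.1, h.apply_zero hcU]
    have h1 := eqOn_Ioo_of_hasDerivAt_zero (u := fun s => energy f (c s, P s y)) (ε := ε)
      (fun s hs => by
        obtain ⟨h1, -, h3, -, -, h6, -⟩ := H s hs
        have hne : P s y ≠ 0 := fun h0 => hy (by rw [← hQP' s hs y, h0, map_zero])
        have h8 : HasDerivAt (fun s => (c s, P s y))
            (deriv c s, -connection f (c s) (deriv c s) (P s y)) s := by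
          refine h3.prodMk ?_
          convert! h1.clm_apply (hasDerivAt_const s y) using 1
          simp [hAdef]
        have h9 := HasFDerivAt.comp_hasDerivAt (f := fun s => (c s, P s y)) s
          (h.differentiableAt_energy h6 hne).hasFDerivAt h8
        rw [h.fderiv_energy_connection h6 hne] at h9
        exact h9) ht
    simp only [hP0, energy] at h1
    exact (pow_left_inj₀ (h.nonneg _ (H t ht).2.2.2.2.2.1 _) (h.nonneg _ hcU _) two_ne_zero).1 h1
  · change P t (deriv c 0) = deriv c t
    rw [← hQw t ht, hPQ']

theorem eventually_distortion_eq (h : IsLocalBerwald f U) {c : ℝ → E n}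
    (hc : ContDiffAt ℝ ∞ c 0) (hcU : c 0 ∈ U) (hc0 : deriv c 0 ≠ 0)
    (hgeo : ∀ᶠ t in 𝓝 (0 : ℝ), deriv (deriv c) t = (-2 : ℝ) • sprayVec f (c t, deriv c t)) :
    ∀ᶠ t in 𝓝 (0 : ℝ), √(fundamentalMatrix f (c t) (deriv c t)).det / htDensityCoord f (c t) =
      √(fundamentalMatrix f (c 0) (deriv c 0)).det / htDensityCoord f (c 0) := by
  filter_upwards [h.exists_linearIsometry hc hcU hc0 hgeo,
    hc.continuousAt.eventually_mem (h.isOpen.mem_nhds hcU)] with t ⟨P, hP, hP'⟩ ht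
  rw [← hP']
  exact h.distortion_of_linearIsometry hcU ht P hP hc0

end IsLocalBerwald
end

end FinslerGeom

/-! ### Invariance of the geodesic equation under coordinate changes -/

namespace FinslerGeom

section

open Set Filter MeasureTheory

variable {n : ℕ} {f f' : E n → E n → ℝ} {U U' W : Set (E n)} {x y : E n} {φ : E n → E n}

/-- `φ` is a change of coordinates on `W` which takes the Finsler metric `f` to `f'`. -/
structure IsCoordChange (f : E n → E n → ℝ) (U : Set (E n)) (f' : E n → E n → ℝ)
    (U' : Set (E n)) (φ : E n → E n) (W : Set (E n)) : Prop where
  isOpen : IsOpen W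
  subset : W ⊆ U
  mapsTo : MapsTo φ W U'
  smooth : ContDiffOn ℝ ∞ φ W
  bijective : ∀ x ∈ W, Function.Bijective (fderiv ℝ φ x)
  eq : ∀ x ∈ W, ∀ y, f x y = f' (φ x) (fderiv ℝ φ x y)

/-- The first variation of the energy along a curve, in terms of its geodesic curvature. -/
theorem IsLocalFinsler.eulerLagrange (h : IsLocalFinsler f U) {c : ℝ → E n} {t : ℝ}
    (hc : ContDiffAt ℝ ∞ c t) (hcU : c t ∈ U) (hc0 : deriv c t ≠ 0) (b : E n) :
    deriv (fun s => fderiv ℝ (energy f) (c s, deriv c s)) t (0, b) -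
        fderiv ℝ (energy f) (c t, deriv c t) (b, 0) =
      hess f (c t, deriv c t) (0, deriv (deriv c) t + (2 : ℝ) • sprayVec f (c t, deriv c t))
        (0, b) := by
  have hw : ContDiffAt ℝ ∞ (deriv c) t :=
    (hc.fderiv_right (m := ∞) (by simp)).clm_apply contDiffAt_const
  have h1 : HasDerivAt (fun s => (c s, deriv c s)) (deriv c t, deriv (deriv c) t) t :=
    (hc.differentiableAt (by simp)).hasDerivAt.prodMk (hw.differentiableAt (by simp)).hasDerivAt
  have h2 := HasFDerivAt.comp_hasDerivAt (f := fun s => (c s, deriv c s)) t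
    (h.differentiableAt_fderiv hcU hc0).hasFDerivAt h1
  have h3 := h.hess_sprayVec hcU hc0 b
  have h4 : ((deriv c t, deriv (deriv c) t) : E n × E n) =
      (deriv c t, 0) + (0, deriv (deriv c) t) := by simp
  have h5 : ((0, deriv (deriv c) t + (2 : ℝ) • sprayVec f (c t, deriv c t)) : E n × E n) =
      (0, deriv (deriv c) t) + (2 : ℝ) • (0, sprayVec f (c t, deriv c t)) := by simp
  have h6 : deriv (fun s => fderiv ℝ (energy f) (c s, deriv c s)) t =
      hess f (c t, deriv c t) (deriv c t, deriv (deriv c) t) := h2.deriv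
  rw [h6, h4, h5]
  simp only [map_add, map_smul, add_apply, smul_apply, smul_eq_mul]
  linarith

/-- Chain rule for the tangent map `(x, y) ↦ (φ x, Dφ y)`; the term `D²φ(a)(y)` comes from the
dependence of `Dφ` on the base point. -/
theorem IsCoordChange.fderiv_energy (hφ : IsCoordChange f U f' U' φ W) (h' : IsLocalFinsler f' U')
    (hx : x ∈ W) (hy : y ≠ 0) (a b : E n) : fderiv ℝ (energy f) (x, y) (a, b) =
      fderiv ℝ (energy f') (φ x, fderiv ℝ φ x y)
        (fderiv ℝ φ x a, fderiv ℝ (fderiv ℝ φ) x a y + fderiv ℝ φ x b) := by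
  have hd : DifferentiableAt ℝ φ x :=
    (hφ.smooth.contDiffAt (hφ.isOpen.mem_nhds hx)).differentiableAt (by simp)
  have hd2 : DifferentiableAt ℝ (fderiv ℝ φ) x :=
    ((hφ.smooth.fderiv_of_isOpen (m := ∞) hφ.isOpen (by simp)).contDiffAt
      (hφ.isOpen.mem_nhds hx)).differentiableAt (by simp)
  have hne : fderiv ℝ φ x y ≠ 0 := fun h0 =>
    hy ((hφ.bijective x hx).1 (by rw [h0, map_zero]))
  have h1 : energy f =ᶠ[𝓝 (x, y)] fun p => energy f' (φ p.1, fderiv ℝ φ p.1 p.2) := by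
    filter_upwards [(hφ.isOpen.prod isOpen_univ).mem_nhds ⟨hx, mem_univ y⟩] with p hp
    simp only [energy, hφ.eq p.1 hp.1]
  have h2 : HasFDerivAt (fun p : E n × E n => φ p.1)
      ((fderiv ℝ φ x).comp (ContinuousLinearMap.fst ℝ (E n) (E n))) (x, y) :=
    HasFDerivAt.comp (g := φ) (x, y) hd.hasFDerivAt hasFDerivAt_fst
  have h3 : HasFDerivAt (fun p : E n × E n => fderiv ℝ φ p.1)
      ((fderiv ℝ (fderiv ℝ φ) x).comp (ContinuousLinearMap.fst ℝ (E n) (E n))) (x, y) :=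
    HasFDerivAt.comp (g := fderiv ℝ φ) (x, y) hd2.hasFDerivAt hasFDerivAt_fst
  have h4 := HasFDerivAt.comp (g := energy f')
    (f := fun p : E n × E n => (φ p.1, fderiv ℝ φ p.1 p.2)) (x, y)
    (h'.differentiableAt_energy (hφ.mapsTo hx) hne).hasFDerivAt
    (h2.prodMk (h3.clm_apply hasFDerivAt_snd))
  rw [h1.fderiv_eq]
  refine (congrArg (fun L : E n × E n →L[ℝ] ℝ => L (a, b)) h4.fderiv).trans ?_
  simp [add_comm]

/-- The geodesic equation is invariant under changes of coordinates. -/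
theorem IsCoordChange.geodesic (hφ : IsCoordChange f U f' U' φ W) (h : IsLocalFinsler f U)
    (h' : IsLocalFinsler f' U') {c : ℝ → E n} {t : ℝ} (hc : ContDiffAt ℝ ∞ c t) (hcW : c t ∈ W)
    (hc0 : deriv c t ≠ 0) (hgeo : deriv (deriv c) t = (-2 : ℝ) • sprayVec f (c t, deriv c t)) :
    deriv (deriv (φ ∘ c)) t =
      (-2 : ℝ) • sprayVec f' (φ (c t), deriv (φ ∘ c) t) := by
  have hφt : ContDiffAt ℝ ∞ φ (c t) := hφ.smooth.contDiffAt (hφ.isOpen.mem_nhds hcW)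
  have hc' : ContDiffAt ℝ ∞ (φ ∘ c) t := hφt.comp t hc
  have hw : ContDiffAt ℝ ∞ (deriv c) t :=
    (hc.fderiv_right (m := ∞) (by simp)).clm_apply contDiffAt_const
  have hw' : ContDiffAt ℝ ∞ (deriv (φ ∘ c)) t :=
    (hc'.fderiv_right (m := ∞) (by simp)).clm_apply contDiffAt_const
  have hone : (1 : WithTop ℕ∞) ≤ ∞ := by exact_mod_cast le_top
  have hcW' : ∀ᶠ s in 𝓝 t, c s ∈ W := hc.continuousAt.eventually_mem (hφ.isOpen.mem_nhds hcW)
  have hvel : ∀ᶠ s in 𝓝 t, deriv (φ ∘ c) s = fderiv ℝ φ (c s) (deriv c s) := by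
    filter_upwards [hcW', (hc.of_le hone).eventually (by simp)] with s hs hcs
    exact (((hφ.smooth.contDiffAt (hφ.isOpen.mem_nhds hs)).differentiableAt
      (by simp)).hasFDerivAt.comp_hasDerivAt s (hcs.differentiableAt (by simp)).hasDerivAt).deriv
  have hne : fderiv ℝ φ (c t) (deriv c t) ≠ 0 := fun h0 =>
    hc0 ((hφ.bijective _ hcW).1 (by rw [h0, map_zero]))
  have hne' : deriv (φ ∘ c) t ≠ 0 := by rwa [hvel.self_of_nhds]
  have hcU' : (φ ∘ c) t ∈ U' := hφ.mapsTo hcW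
  have hEL : ∀ b, hess f' ((φ ∘ c) t, deriv (φ ∘ c) t) (0, deriv (deriv (φ ∘ c)) t +
      (2 : ℝ) • sprayVec f' ((φ ∘ c) t, deriv (φ ∘ c) t)) (0, b) = 0 := by
    intro b'
    -- Test vectors in the new chart are images of old ones, so the two Euler–Lagrange expressions
    -- can be compared.
    obtain ⟨b, rfl⟩ := (hφ.bijective _ hcW).2 b'
    rw [← h'.eulerLagrange hc' hcU' hne']
    have h1 := h.eulerLagrange hc (hφ.subset hcW) hc0 b
    have hz : ((0, deriv (deriv c) t + (2 : ℝ) • sprayVec f (c t, deriv c t)) : E n × E n) = 0 := by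
      rw [hgeo]; simp
    rw [hz, map_zero, zero_apply, hφ.fderiv_energy h' hcW hc0] at h1
    have hp : DifferentiableAt ℝ (fun s => fderiv ℝ (energy f) (c s, deriv c s)) t :=
      DifferentiableAt.comp (g := fderiv ℝ (energy f)) (f := fun s => (c s, deriv c s)) t
        (h.differentiableAt_fderiv (hφ.subset hcW) hc0)
        ((hc.differentiableAt (by simp)).prodMk (hw.differentiableAt (by simp)))
    have hp' : DifferentiableAt ℝ
        (fun s => fderiv ℝ (energy f') ((φ ∘ c) s, deriv (φ ∘ c) s)) t :=
      DifferentiableAt.comp (g := fderiv ℝ (energy f'))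
        (f := fun s => ((φ ∘ c) s, deriv (φ ∘ c) s)) t
        (h'.differentiableAt_fderiv hcU' hne')
        ((hc'.differentiableAt (by simp)).prodMk (hw'.differentiableAt (by simp)))
    have hφ2 : HasFDerivAt (fderiv ℝ φ) (fderiv ℝ (fderiv ℝ φ) (c t)) (c t) :=
      ((hφt.fderiv_right (m := ∞) (by simp)).differentiableAt (by simp)).hasFDerivAt
    have hB : HasDerivAt (fun s => fderiv ℝ φ (c s)) (fderiv ℝ (fderiv ℝ φ) (c t) (deriv c t)) t :=
      hφ2.comp_hasDerivAt t (hc.differentiableAt (by simp)).hasDerivAt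
    have h2 : (fun s => fderiv ℝ (energy f) (c s, deriv c s) (0, b)) =ᶠ[𝓝 t] fun s =>
        fderiv ℝ (energy f') ((φ ∘ c) s, deriv (φ ∘ c) s) (0, fderiv ℝ φ (c s) b) := by
      filter_upwards [hcW', hvel, hw.continuousAt.eventually_ne hc0] with s hs hs' hs0
      rw [hs', hφ.fderiv_energy h' hs hs0]
      simp
    have h3 := (hp.hasDerivAt.clm_apply (hasDerivAt_const t ((0, b) : E n × E n))).unique
      ((hp'.hasDerivAt.clm_apply ((hasDerivAt_const t (0 : E n)).prodMk
        (hB.clm_apply (hasDerivAt_const t b)))).congr_of_eventuallyEq h2)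
    -- The time derivative of the momentum contributes `D²φ(ċ)(b)`, the base derivative of the
    -- energy `D²φ(b)(ċ)`; symmetry makes them cancel.
    have hsymm : fderiv ℝ (fderiv ℝ φ) (c t) b (deriv c t) =
        fderiv ℝ (fderiv ℝ φ) (c t) (deriv c t) b :=
      hφt.isSymmSndFDerivAt (by simpa using WithTop.coe_le_coe.2 (le_top (a := (2 : ℕ∞)))) _ _
    have h4 : ((fderiv ℝ φ (c t) b, fderiv ℝ (fderiv ℝ φ) (c t) b (deriv c t) +
        fderiv ℝ φ (c t) 0) : E n × E n) = (fderiv ℝ φ (c t) b, 0) +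
          (0, fderiv ℝ (fderiv ℝ φ) (c t) (deriv c t) b) := by
      simp [hsymm]
    rw [h4, map_add, ← hvel.self_of_nhds] at h1
    simp only [map_zero, add_zero] at h3
    rw [h3] at h1
    simp only [Function.comp_apply] at h1 ⊢
    linarith
  have := h'.eq_zero_of_hess hcU' hne' hEL
  rw [neg_smul]
  exact eq_neg_of_add_eq_zero_left this

end

end FinslerGeom

/-! ### From charts of the manifold to local Finsler metrics -/

namespace FinslerGeom

section

open Set Filter MeasureTheory

variable {n : ℕ} {M : Type*} [TopologicalSpace M] [ChartedSpace (E n) M]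

/-- The derivative of the chart `e` at `p`, as a map of the model space. -/
def chartDeriv (e : OpenPartialHomeomorph M (E n)) (p : M) : E n →L[ℝ] E n :=
  mfderiv (𝓡 n) (𝓡 n) e p

/-- The derivative of the inverse of the chart `e` at `x`, as a map of the model space. -/
def chartSymmDeriv (e : OpenPartialHomeomorph M (E n)) (x : E n) : E n →L[ℝ] E n :=
  mfderiv (𝓡 n) (𝓡 n) e.symm x

/-- The tangent vector at `p` with components `a` in the preferred chart at `p`. -/
def tangentMk (p : M) (a : E n) : TangentBundle (𝓡 n) M := ⟨p, a⟩

theorem coordRep_eq (F : TangentBundle (𝓡 n) M → ℝ) (e : OpenPartialHomeomorph M (E n))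
    (x y : E n) : coordRep F e x y = F (tangentMk (e.symm x) (chartSymmDeriv e x y)) := rfl

variable {F : TangentBundle (𝓡 n) M → ℝ} {e e' : OpenPartialHomeomorph M (E n)}

theorem IsChart.mdifferentiable (he : IsChart e) : e.MDifferentiable (𝓡 n) (𝓡 n) :=
  ⟨(contMDiffOn_of_mem_maximalAtlas he).mdifferentiableOn (by simp),
    (contMDiffOn_symm_of_mem_maximalAtlas he).mdifferentiableOn (by simp)⟩

theorem IsChart.chartDeriv_chartSymmDeriv (he : IsChart e) {x : E n} (hx : x ∈ e.target)
    (y : E n) : chartDeriv e (e.symm x) (chartSymmDeriv e x y) = y :=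
  congrArg (fun L : E n →L[ℝ] E n => L y) (he.mdifferentiable.comp_symm_deriv hx)

theorem IsChart.chartSymmDeriv_chartDeriv (he : IsChart e) {p : M} (hp : p ∈ e.source)
    (y : E n) : chartSymmDeriv e (e p) (chartDeriv e p y) = y :=
  congrArg (fun L : E n →L[ℝ] E n => L y) (he.mdifferentiable.symm_comp_deriv hp)

theorem IsChart.chartSymmDeriv_ne_zero (he : IsChart e) {x y : E n} (hx : x ∈ e.target)
    (hy : y ≠ 0) : chartSymmDeriv e x y ≠ 0 := fun h0 =>
  hy (by rw [← he.chartDeriv_chartSymmDeriv hx y, h0, map_zero])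

theorem contMDiff_tangentMk :
    ContMDiff 𝓘(ℝ, E n × E n) (𝓡 n).tangent ∞
      (fun p : E n × E n => (tangentMk p.1 p.2 : TangentBundle (𝓡 n) (E n))) := by
  have := contMDiff_tangentBundleModelSpaceHomeomorph_symm (I := 𝓡 n) (n := ∞)
  rw [modelWithCornersSelf_prod]
  exact this

/-- Both coordinate expressions evaluate `F` at the same tangent vector, so this holds for an
arbitrary function `F`. -/
theorem isCoordChange (F : TangentBundle (𝓡 n) M → ℝ) (he : IsChart e) (he' : IsChart e') :
    IsCoordChange (coordRep F e) e.target (coordRep F e') e'.target (e' ∘ e.symm)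
      (e.symm ≫ₕ e').source where
  isOpen := (e.symm ≫ₕ e').open_source
  subset x hx := by simp at hx; exact hx.1
  mapsTo x hx := by simp at hx; exact e'.map_source hx.2
  smooth := by
    rw [← contMDiffOn_iff_contDiffOn]
    exact (contMDiffOn_of_mem_maximalAtlas he').comp
      ((contMDiffOn_symm_of_mem_maximalAtlas he).mono fun x hx => by simp at hx; exact hx.1)
      fun x hx => by simp at hx; exact hx.2
  bijective x hx := by
    rw [← mfderiv_eq_fderiv]
    exact (he.mdifferentiable.symm.trans he'.mdifferentiable).mfderiv_bijective hx
  eq x hx y := by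
    have hx1 : x ∈ e.target := by simp at hx; exact hx.1
    have hx2 : e.symm x ∈ e'.source := by simp at hx; exact hx.2
    have h1 : fderiv ℝ (e' ∘ e.symm) x y =
        chartDeriv e' (e.symm x) (chartSymmDeriv e x y) := by
      rw [← mfderiv_eq_fderiv]
      exact congrArg (fun L : E n →L[ℝ] E n => L y)
        (mfderiv_comp x (he'.mdifferentiable.mdifferentiableAt hx2)
          (he.mdifferentiable.mdifferentiableAt_symm hx1))
    rw [h1, coordRep_eq, coordRep_eq, Function.comp_apply, he'.chartSymmDeriv_chartDeriv hx2,
      e'.left_inv hx2]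

variable [IsManifold (𝓡 n) ∞ M]

instance isManifold_one : IsManifold (𝓡 n) 1 M :=
  IsManifold.of_le (n := ∞) (by exact_mod_cast le_top)

/-- The expression is `F` composed with the tangent map of the inverse chart, which is injective on
fibres and so stays off the zero section. -/
theorem IsFinslerMetric.contDiffOn_coordRep (hF : IsFinslerMetric F) (he : IsChart e) :
    ContDiffOn ℝ ∞ (fun p : E n × E n => coordRep F e p.1 p.2) (e.target ×ˢ {0}ᶜ) := by
  rw [← contMDiffOn_iff_contDiffOn]
  have h1 := (contMDiffOn_symm_of_mem_maximalAtlas he).contMDiffOn_tangentMapWithin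
    (m := ∞) (by simp) e.open_target.uniqueMDiffOn
  have h2 : ContMDiffOn (𝓡 n).tangent (𝓡 n).tangent ∞ (tangentMap (𝓡 n) (𝓡 n) e.symm)
      (Bundle.TotalSpace.proj ⁻¹' e.target) := by
    refine h1.congr fun p hp => ?_
    simp only [tangentMap, tangentMapWithin]
    rw [mfderivWithin_of_isOpen e.open_target hp]
  refine hF.smooth.comp (h2.comp contMDiff_tangentMk.contMDiffOn fun p hp => hp.1) fun p hp => ?_
  exact he.chartSymmDeriv_ne_zero hp.1 hp.2

theorem IsFinslerMetric.isLocalFinsler (hF : IsFinslerMetric F) (he : IsChart e) :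
    IsLocalFinsler (coordRep F e) e.target where
  isOpen := e.open_target
  nonneg x _ y := hF.nonneg _
  smooth := hF.contDiffOn_coordRep he
  homogeneous x _ y c hc := by
    rw [coordRep_eq, map_smul]
    exact hF.homogeneous _ _ c hc
  posDef := hF.posDef e he

theorem IsBerwaldMetric.isLocalBerwald (hF : IsBerwaldMetric F) (he : IsChart e) :
    IsLocalBerwald (coordRep F e) e.target where
  toIsLocalFinsler := hF.toIsFinslerMetric.isLocalFinsler he
  quadratic := hF.quadratic e he

end

end FinslerGeom

/-! ### Geodesics and distortion on the manifold -/

namespace FinslerGeom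

section

open Set Filter MeasureTheory

variable {n : ℕ} {M : Type*} [TopologicalSpace M] [ChartedSpace (E n) M]
  {F : TangentBundle (𝓡 n) M → ℝ} {e e' : OpenPartialHomeomorph M (E n)}

theorem IsChart.coordVec_velocity (he : IsChart e) {γ : ℝ → M} {t : ℝ}
    (hγ : MDifferentiableAt 𝓘(ℝ, ℝ) (𝓡 n) γ t) (ht : γ t ∈ e.source) :
    coordVec e (velocity γ t) = deriv (fun s => e (γ s)) t := by
  rw [← fderiv_apply_one_eq_deriv, ← mfderiv_eq_fderiv]
  exact (congrArg (fun L : ℝ →L[ℝ] E n => L 1)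
    (mfderiv_comp t (he.mdifferentiable.mdifferentiableAt ht) hγ)).symm

theorem IsChart.velocity_symm_comp (he : IsChart e) {c : ℝ → E n} {t : ℝ}
    (hc : DifferentiableAt ℝ c t) (ht : c t ∈ e.target) :
    velocity (e.symm ∘ c) t = tangentMk (e.symm (c t)) (chartSymmDeriv e (c t) (deriv c t)) := by
  refine congrArg (tangentMk (e.symm (c t))) ?_
  rw [← fderiv_apply_one_eq_deriv, ← mfderiv_eq_fderiv]
  exact congrArg (fun L : ℝ →L[ℝ] E n => L 1)
    (mfderiv_comp t (he.mdifferentiable.mdifferentiableAt_symm ht) hc.mdifferentiableAt)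

variable [IsManifold (𝓡 n) ∞ M]

/-- Local existence of geodesics with given initial velocity. -/
theorem IsFinslerMetric.exists_isGeodesicOn (hF : IsFinslerMetric F) (v : TangentBundle (𝓡 n) M)
    (hv : v.2 ≠ 0) :
    ∃ ε > 0, ∃ γ : ℝ → M, IsGeodesicOn F γ (Ioo (-ε) ε) ∧ velocity γ 0 = v := by
  obtain ⟨p, w⟩ := v
  set e := chartAt (E n) p
  have he : IsChart e := IsManifold.chart_mem_maximalAtlas p
  have hp : p ∈ e.source := mem_chart_source _ p
  have hy : chartDeriv e p w ≠ 0 := fun h0 =>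
    hv (by rw [← he.chartSymmDeriv_chartDeriv hp w, h0, map_zero]; rfl)
  have hloc := hF.isLocalFinsler he
  obtain ⟨ε, hε, c, hc0, hc0', hcs, hc⟩ := hloc.exists_geodesic (e.map_source hp) hy
  have hcAt : ∀ t ∈ Ioo (-ε) ε, ContDiffAt ℝ ∞ c t := fun t ht =>
    hcs.contDiffAt (isOpen_Ioo.mem_nhds ht)
  have h0 : (0 : ℝ) ∈ Ioo (-ε) ε := ⟨neg_lt_zero.2 hε, hε⟩
  refine ⟨ε, hε, e.symm ∘ c, ⟨?_, ?_⟩, ?_⟩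
  · exact (contMDiffOn_symm_of_mem_maximalAtlas he).comp hcs.contMDiffOn fun t ht => (hc t ht).1
  · intro e' he' t ht hte i
    -- The curve was solved for in one chart only; the equation in any other chart follows by
    -- coordinate invariance.
    have h1 := (isCoordChange F he he').geodesic hloc (hF.isLocalFinsler he') (hcAt t ht)
      (by simpa using ⟨(hc t ht).1, hte⟩) (hc t ht).2.1 (hc t ht).2.2
    have h2 := congrArg (fun a : E n => a i) h1
    have h3 : deriv (deriv fun s => e' ((e.symm ∘ c) s)) t i =
      -2 * geodesicCoeff (coordRep F e') i (e' ((e.symm ∘ c) t))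
        (deriv (fun s => e' ((e.symm ∘ c) s)) t) := h2
    rw [h3]; ring
  · rw [he.velocity_symm_comp ((hcAt 0 h0).differentiableAt (by simp)) (hc 0 h0).1, hc0, hc0']
    refine (congrArg (tangentMk _) (he.chartSymmDeriv_chartDeriv hp w)).trans ?_
    rw [e.left_inv hp]
    rfl

/-- The distortion for the Holmes–Thompson measure is constant along the geodesics of a Berwald
metric. -/
theorem IsBerwaldMetric.eventually_distortion_eq (hF : IsBerwaldMetric F) {γ : ℝ → M} {ε : ℝ}
    (hε : 0 < ε) (hγ : IsGeodesicOn F γ (Ioo (-ε) ε)) (hv : (velocity (n := n) γ 0).2 ≠ 0)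
    (he : IsChart e) (h0e : γ 0 ∈ e.source) :
    ∀ᶠ t in 𝓝 (0 : ℝ), distortion F (holmesThompson F) e (velocity γ t) =
      distortion F (holmesThompson F) e (velocity γ 0) := by
  have h0 : (0 : ℝ) ∈ Ioo (-ε) ε := ⟨neg_lt_zero.2 hε, hε⟩
  have hγAt : ∀ t ∈ Ioo (-ε) ε, ContMDiffAt 𝓘(ℝ, ℝ) (𝓡 n) ∞ γ t := fun t ht =>
    hγ.smooth.contMDiffAt (isOpen_Ioo.mem_nhds ht)
  have hc : ContDiffAt ℝ ∞ (fun s => e (γ s)) 0 := by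
    rw [← contMDiffAt_iff_contDiffAt]
    exact (contMDiffAt_of_mem_maximalAtlas he h0e).comp 0 (hγAt 0 h0)
  have hvel : ∀ t ∈ Ioo (-ε) ε, γ t ∈ e.source →
      coordVec e (velocity γ t) = deriv (fun s => e (γ s)) t := fun t ht hte =>
    he.coordVec_velocity ((hγAt t ht).mdifferentiableAt (by simp)) hte
  have hc0 : deriv (fun s => e (γ s)) 0 ≠ 0 := by
    rw [← hvel 0 h0 h0e]
    intro h
    refine hv ((he.chartSymmDeriv_chartDeriv h0e (velocity γ 0).2).symm.trans ?_)
    change chartSymmDeriv e (e (γ 0)) (coordVec e (velocity γ 0)) = 0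
    rw [h, map_zero]
  have hsrc : ∀ᶠ t in 𝓝 (0 : ℝ), t ∈ Ioo (-ε) ε ∧ γ t ∈ e.source :=
    ((isOpen_Ioo (a := -ε) (b := ε)).eventually_mem h0).and
      ((hγAt 0 h0).continuousAt.eventually_mem (e.open_source.mem_nhds h0e))
  have hgeo : ∀ᶠ t in 𝓝 (0 : ℝ), deriv (deriv fun s => e (γ s)) t =
      (-2 : ℝ) • sprayVec (coordRep F e) (e (γ t), deriv (fun s => e (γ s)) t) := by
    filter_upwards [hsrc] with t ht
    ext i
    have h1 := hγ.equation e he t ht.1 ht.2 i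
    change _ = -2 * geodesicCoeff (coordRep F e) i (e (γ t)) (deriv (fun s => e (γ s)) t)
    linarith
  filter_upwards [hsrc, (hF.isLocalBerwald he).eventually_distortion_eq hc (e.map_source h0e) hc0
    hgeo] with t ht h1
  change Real.log (√(fundamentalMatrix (coordRep F e) (e (γ t))
      (coordVec e (velocity γ t))).det / htDensityCoord (coordRep F e) (e (γ t))) =
    Real.log (√(fundamentalMatrix (coordRep F e) (e (γ 0))
      (coordVec e (velocity γ 0))).det / htDensityCoord (coordRep F e) (e (γ 0)))
  rw [hvel t ht.1 ht.2, hvel 0 h0 h0e, h1]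

end

end FinslerGeom

end

theorem mainTheorem6 {n : ℕ} {M : Type*} [TopologicalSpace M]
    [ChartedSpace (EuclideanSpace ℝ (Fin n)) M] [IsManifold (𝓡 n) ∞ M]
    (F : TangentBundle (𝓡 n) M → ℝ) (hF : FinslerGeom.IsBerwaldMetric F)
    (v : TangentBundle (𝓡 n) M) (hv : v.2 ≠ 0) :
    FinslerGeom.HasSCurvature F (FinslerGeom.holmesThompson F) v 0 := by
  refine ⟨hF.toIsFinslerMetric.exists_isGeodesicOn v hv, ?_⟩
  rintro ε hε γ hγ rfl e he hve
  -- The distortion is constant near `t = 0`, which gives differentiability and the value `0`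
  -- together.
  exact (hasDerivAt_const 0 _).congr_of_eventuallyEq
    (hF.eventually_distortion_eq hε hγ hv he hve)
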